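/- Let $\delta>0$, let $E\subset\delta\mathbb{Z}^d=\{\delta k: k\in\mathbb{Z}^d\}$, and let $\{X(t)\}_{t\ge 0}$ be a (time-homogeneous, right-continuous, $E$-valued) continuous-time Markov chain on $E$ with transition rates $q_{k,k'}\ge 0$ from $\delta k$ to $\delta k'$ ($k\ne k'$), where $q_{k,k'}=0$ if $\delta k\in E$ and $\delta k'\notin E$, and $\sum_{k'\neq k}q_{k,k'}<\infty$ for every $\delta k\in E$. That is, as $t\downarrow 0$, $\mathbb{P}_{\delta k}(X(t)=\delta k')/t\to q_{k,k'}$ for $k'\ne k$ with $\delta k'\in E$, and $(1-\mathbb{P}_{\delta k}(X(t)=\delta k))/t\to\sum_{k'\ne k}q_{k,k'}$. Its generator is $$G_Xf(\delta k)=\sum_{k'\in\mathbb{Z}^d}q_{k,k'}\big(f(\delta k')-f(\delta k)\big),\qquad \delta k\in E.$$ Put $\beta_\ell(\delta k)=q_{k,k+\ell}$. Let $X$ have a stationary distribution of the chain, and assume that every $\delta k\in E$ either satisfies $\mathbb{P}(X=\delta k)>0$ or has only finitely many $k'$ with $q_{k,k'}\neq 0$ (this is automatic if the chain is irreducible, since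 then $\mathbb{P}(X=\delta k)>0$ for all $\delta k\in E$). Let $h:\delta\mathbb{Z}^d\to\mathbb{R}$ satisfy $\mathbb{E}|h(X)|<\infty$ and $\mathbb{E}_{\delta k}|h(X(t))|<\infty$ for all $\delta k\in E$, $t\ge 0$, where $\mathbb{E}_{\delta k}$ is expectation given $X(0)=\delta k$. Suppose that for every $\delta k\in E$ the integral $$g(\delta k)=\int_0^\infty\big(\mathbb{E}_{\delta k}h(X(t))-\mathbb{E}h(X)\big)\,dt=\lim_{T\to\infty}\int_0^T\big(\mathbb{E}_{\delta k}h(X(t))-\mathbb{E}h(X)\big)\,dt$$ exists and is finite (absolute convergence is not required), and that $$\sum_{\ell\in\mathbb{Z}^d}\big|\beta_\ell(\delta k)\big(g(\delta(k+\ell))-g(\delta k)\big)\big|<\infty\qquad\text{for all }\delta k\in E$$ (terms with $\beta_\ell(\delta k)=0$ are read as $0$). Then $g$ solves the Poisson equation of the chain: $$G_Xg(\delta k)=\mathbb{E}h(X)-h(\delta k)\qquad\text{for all }\delta k\in E.$$ -/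

import Mathlib

open MeasureTheory Filter Topology
open scoped NNReal ENNReal

noncomputable section

/-- The point `δ k` of the scaled lattice `δ ℤ^d`, viewed in `ℝ^d`. -/
def latticePoint {d : ℕ} (δ : ℝ) (k : Fin d → ℤ) : EuclideanSpace ℝ (Fin d) :=
  WithLp.toLp 2 fun i => δ * (k i : ℝ)

/-- The scaled lattice `δ ℤ^d = {δ k : k ∈ ℤ^d}`. -/
def scaledLattice (d : ℕ) (δ : ℝ) : Set (EuclideanSpace ℝ (Fin d)) :=
  Set.range (latticePoint δ)

/-- `q k k'` (for `k ≠ k'`) are the rates of transition from `δ k` to `δ k'` of a chain living on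
`E`: they are nonnegative, no transition leaves `E`, and the total rate out of each state is finite.
The diagonal entries `q k k` carry no information. -/
structure IsTransitionRates {d : ℕ} (δ : ℝ) (E : Set (EuclideanSpace ℝ (Fin d)))
    (q : (Fin d → ℤ) → (Fin d → ℤ) → ℝ) : Prop where
  nonneg : ∀ k k', latticePoint δ k ∈ E → k ≠ k' → 0 ≤ q k k'
  eq_zero : ∀ k k', latticePoint δ k ∈ E → latticePoint δ k' ∉ E → q k k' = 0
  summable : ∀ k, latticePoint δ k ∈ E → Summable (q k)

/-- The total rate at which the chain leaves `δ k`, namely `∑_{k' ≠ k} q k k'`. -/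
def exitRate {d : ℕ} (q : (Fin d → ℤ) → (Fin d → ℤ) → ℝ) (k : Fin d → ℤ) : ℝ :=
  ∑' k', if k' = k then 0 else q k k'

/-- The rate `β_ℓ(δ k)` of a jump by `δ ℓ` out of `δ k`. -/
def jumpRate {d : ℕ} (q : (Fin d → ℤ) → (Fin d → ℤ) → ℝ) (l k : Fin d → ℤ) : ℝ :=
  q k (k + l)

/-- The generator `G_X f(δ k) = ∑_{k'} q k k' (f(δ k') - f(δ k))`. -/
def ctmcGenerator {d : ℕ} (δ : ℝ) (q : (Fin d → ℤ) → (Fin d → ℤ) → ℝ)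
    (f : EuclideanSpace ℝ (Fin d) → ℝ) (k : Fin d → ℤ) : ℝ :=
  ∑' k', q k k' * (f (latticePoint δ k') - f (latticePoint δ k))

/-- `X` is a continuous-time Markov chain on `E ⊆ δ ℤ^d` with transition rates `q`; the law of the
chain started at `x ∈ E` is `P x` (for `x ∉ E`, the measure `P x` is irrelevant).
The field `markov` is the Markov property with respect to the natural filtration, together with
time-homogeneity. -/
structure IsCTMC {d : ℕ} {Ω : Type*} [MeasurableSpace Ω] (δ : ℝ)
    (E : Set (EuclideanSpace ℝ (Fin d))) (q : (Fin d → ℤ) → (Fin d → ℤ) → ℝ)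
    (P : EuclideanSpace ℝ (Fin d) → Measure Ω)
    (X : ℝ≥0 → Ω → EuclideanSpace ℝ (Fin d)) : Prop where
  subset_lattice : E ⊆ scaledLattice d δ
  rates : IsTransitionRates δ E q
  isProbability : ∀ x ∈ E, IsProbabilityMeasure (P x)
  measurable : ∀ t, Measurable (X t)
  mem_states : ∀ t ω, X t ω ∈ E
  rightContinuous : ∀ x ∈ E, ∀ᵐ ω ∂(P x),
    ∀ t, ContinuousWithinAt (fun s => X s ω) (Set.Ici t) t
  initial : ∀ x ∈ E, ∀ᵐ ω ∂(P x), X 0 ω = x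
  markov : ∀ x ∈ E, ∀ y ∈ E, ∀ z ∈ E, ∀ s t : ℝ≥0, ∀ A : Set Ω,
    MeasurableSet[⨆ r : Set.Iic s, MeasurableSpace.comap (X r) inferInstance] A →
    P x (A ∩ {ω | X s ω = y} ∩ {ω | X (s + t) ω = z})
      = P x (A ∩ {ω | X s ω = y}) * P y {ω | X t ω = z}
  jump : ∀ k k', latticePoint δ k ∈ E → latticePoint δ k' ∈ E → k ≠ k' →
    Tendsto (fun t : ℝ≥0 => (P (latticePoint δ k)).real {ω | X t ω = latticePoint δ k'} / (t : ℝ))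
      (𝓝[>] 0) (𝓝 (q k k'))
  hold : ∀ k, latticePoint δ k ∈ E →
    Tendsto (fun t : ℝ≥0 =>
        (1 - (P (latticePoint δ k)).real {ω | X t ω = latticePoint δ k}) / (t : ℝ))
      (𝓝[>] 0) (𝓝 (exitRate q k))

/-- `π` is a stationary distribution of the chain: a probability measure carried by `E` with
`∑_{x ∈ E} π(x) P_x(X(t) = y) = π(y)` for all `t ≥ 0` and `y ∈ E`. -/
structure IsStationaryDistribution {d : ℕ} {Ω : Type*} [MeasurableSpace Ω]
    (E : Set (EuclideanSpace ℝ (Fin d))) (P : EuclideanSpace ℝ (Fin d) → Measure Ω)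
    (X : ℝ≥0 → Ω → EuclideanSpace ℝ (Fin d)) (π : Measure (EuclideanSpace ℝ (Fin d))) :
    Prop where
  isProbability : IsProbabilityMeasure π
  carried : π Eᶜ = 0
  invariant : ∀ t : ℝ≥0, ∀ y ∈ E, ∑' x : E, π {(x : EuclideanSpace ℝ (Fin d))} *
    P (x : EuclideanSpace ℝ (Fin d)) {ω | X t ω = y} = π {y}

end

/-! Replace `h` by its centred version `f = h - E h(X)`, and let `λ` be the exit rate of `x`. It
must be shown that `∑ r(x,y) g(y) = λ g(x) - f(x)`. The tool is Kolmogorov's backward equation.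
Scheffé's lemma gives it as a right derivative, because the weights `p_s(x,y)/s` converge to the
rates together with their total mass.

At a state `x` charged by the stationary law, work with the resolvents `R_α` and `g_α(y) = ∑ f(z)
R_α(y,z)`. The Laplace-transformed backward equation is `∑ r(x,y) g_α(y) = (λ + α) g_α(x) - f(x)`.
Stationarity gives `μ(y) p_t(y,z) ≤ μ(z)`. Hence every state reachable by one jump from `x` is
charged, and expectations from charged states are bounded and continuous in time, so Abel's theorem
gives `g_α → g` there even when the integral converges only conditionally.

What remains is to let `α → 0` inside the sum over `y`, which needs a summable bound on `r(x,y)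
|g_α(y)|` uniform in `α`. Split `g_α(y)` at the first visit to `x`. After the visit the contribution
is controlled by `|f(x)| + |g_α(x)|`, which is bounded. Before it, the contribution is at most the
taboo resolvent applied to `|f|`; averaged over the jump out of `x`, this is at most `(λ + 1)
μ(z)/μ(x)` in the variable `z`. Up to the factor `1 - α` the taboo resolvent increases as `α`
decreases, so the bound passes to the supremum over `α`. Visits are counted along the discrete chain
with kernel `R_1` and discount `1 - α`, whose Green kernel is `1 + (1 - α) R_α`; the positivity and
monotonicity needed follow from a minimum principle.

At a state with finitely many possible jumps, Dynkin's formula on `[0,T]` involves finite sums only.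
Its right side converges as `T → ∞`, so `E_x f(X(T))` converges; since its time integral converges
too, the limit is zero, and the equation follows. -/

/-! ### Laplace integrals and Abel's theorem. -/

theorem hasSum_integral_of_sum_norm_le {ι : Type*} [Countable ι] {μ : Measure ℝ}
    {f : ι → ℝ → ℝ} {bound : ℝ → ℝ} (hf : ∀ i, AEStronglyMeasurable (f i) μ)
    (hb : Integrable bound μ)
    (h : ∀ᵐ t ∂μ, ∀ F : Finset ι, ∑ i ∈ F, ‖f i t‖ ≤ bound t) :
    HasSum (fun i => ∫ t, f i t ∂μ) (∫ t, ∑' i, f i t ∂μ) := by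
  have hint : ∀ i, Integrable (f i) μ := fun i => by
    refine hb.mono' (hf i) ?_
    filter_upwards [h] with t ht
    simpa using ht {i}
  refine hasSum_integral_of_summable_integral_norm hint ?_
  refine summable_of_sum_le (c := ∫ t, bound t ∂μ)
    (fun i => integral_nonneg fun t => norm_nonneg _) fun F => ?_
  rw [← integral_finsetSum _ fun i _ => (hint i).norm]
  refine integral_mono_ae (integrable_finsetSum _ fun i _ => (hint i).norm) hb ?_
  filter_upwards [h] with t ht using ht F

theorem integrableOn_exp_neg_mul_of_bounded {f : ℝ → ℝ} (hf : Continuous f) {C β : ℝ}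
    (hβ : 0 < β) (hC : ∀ t, 0 ≤ t → |f t| ≤ C) :
    IntegrableOn (fun t => Real.exp (-β * t) * f t) (Set.Ioi 0) := by
  refine Integrable.mono' ((exp_neg_integrableOn_Ioi 0 hβ).mul_const C)
    (by fun_prop) ?_
  filter_upwards [ae_restrict_mem measurableSet_Ioi] with t ht
  rw [norm_mul, Real.norm_of_nonneg (Real.exp_pos _).le, Real.norm_eq_abs]
  exact mul_le_mul_of_nonneg_left (hC t (le_of_lt ht)) (Real.exp_pos _).le

theorem integral_exp_neg_mul_Ioi {β : ℝ} (hβ : 0 < β) :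
    ∫ t in Set.Ioi (0 : ℝ), Real.exp (-β * t) = β⁻¹ := by
  rw [integral_exp_mul_Ioi (by linarith)]
  simp [neg_div]

theorem tendsto_exp_neg_mul_mul_of_bounded {F : ℝ → ℝ} {C β : ℝ} (hβ : 0 < β)
    (hC : ∀ t, 0 ≤ t → |F t| ≤ C) :
    Tendsto (fun t => Real.exp (-β * t) * F t) atTop (𝓝 0) := by
  have h0 : Tendsto (fun t : ℝ => Real.exp (-β * t) * C) atTop (𝓝 0) := by
    have : Tendsto (fun t : ℝ => -β * t) atTop atBot :=
      tendsto_id.const_mul_atTop_of_neg (by linarith)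
    simpa using (Real.tendsto_exp_atBot.comp this).mul_const C
  refine squeeze_zero_norm' ?_ h0
  filter_upwards [eventually_ge_atTop 0] with t ht
  rw [norm_mul, Real.norm_of_nonneg (Real.exp_pos _).le, Real.norm_eq_abs]
  exact mul_le_mul_of_nonneg_left (hC t ht) (Real.exp_pos _).le

/-- Laplace transforms and integration: `∫ e^{-βt} f = β ∫ e^{-βt} F` with `F = ∫_0^· f`. -/
theorem integral_exp_neg_mul_eq_mul_integral {f : ℝ → ℝ} (hf : Continuous f) {C M β : ℝ}
    (hβ : 0 < β) (hC : ∀ t, 0 ≤ t → |f t| ≤ C)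
    (hM : ∀ T, 0 ≤ T → |∫ t in (0 : ℝ)..T, f t| ≤ M) :
    ∫ t in Set.Ioi (0 : ℝ), Real.exp (-β * t) * f t
      = β * ∫ t in Set.Ioi (0 : ℝ), Real.exp (-β * t) * ∫ s in (0 : ℝ)..t, f s := by
  have hder : ∀ t, HasDerivAt (fun T => ∫ s in (0 : ℝ)..T, f s) (f t) t := fun t =>
    intervalIntegral.integral_hasDerivAt_right (hf.intervalIntegrable _ _)
      (hf.stronglyMeasurableAtFilter _ _) hf.continuousAt
  have hcont : Continuous fun T => ∫ s in (0 : ℝ)..T, f s :=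
    continuous_iff_continuousAt.2 fun t => (hder t).continuousAt
  have hexp : ∀ t, HasDerivAt (fun t => Real.exp (-β * t)) (-β * Real.exp (-β * t)) t := fun t => by
    have := ((hasDerivAt_id t).const_mul (-β)).exp
    simpa [mul_comm] using this
  have key := integral_Ioi_mul_deriv_eq_deriv_mul (a := (0 : ℝ)) (a' := (0 : ℝ)) (b' := (0 : ℝ))
    (u := fun t => Real.exp (-β * t)) (v := fun T => ∫ s in (0 : ℝ)..T, f s)
    (u' := fun t => -β * Real.exp (-β * t)) (v' := f)
    (fun t _ => hexp t) (fun t _ => hder t)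
    (integrableOn_exp_neg_mul_of_bounded hf hβ hC)
    (by
      have := (integrableOn_exp_neg_mul_of_bounded hcont hβ hM).const_mul (-β)
      refine this.congr (ae_of_all _ fun t => ?_)
      simp [mul_assoc])
    (by
      have : Continuous fun t => Real.exp (-β * t) * ∫ s in (0 : ℝ)..t, f s := by fun_prop
      have h2 := (this.tendsto 0).mono_left (nhdsWithin_le_nhds (s := Set.Ioi 0))
      simpa [Pi.mul_def] using h2)
    (tendsto_exp_neg_mul_mul_of_bounded hβ hM)
  rw [key, ← integral_const_mul, sub_zero, zero_sub, ← integral_neg]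
  congr 1 with t
  ring

/-- **Abel's theorem** for improper integrals. -/
theorem tendsto_integral_exp_neg_mul {f : ℝ → ℝ} (hf : Continuous f) {C L : ℝ}
    (hC : ∀ t, 0 ≤ t → |f t| ≤ C)
    (hL : Tendsto (fun T => ∫ t in (0 : ℝ)..T, f t) atTop (𝓝 L)) :
    Tendsto (fun α : ℝ => ∫ t in Set.Ioi (0 : ℝ), Real.exp (-α * t) * f t) (𝓝[>] 0) (𝓝 L) := by
  set F : ℝ → ℝ := fun T => ∫ t in (0 : ℝ)..T, f t with hF
  have hFc : Continuous F := intervalIntegral.continuous_primitive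
    (fun a b => hf.intervalIntegrable a b) 0
  -- A continuous primitive with a limit at infinity is bounded on the half-line.
  obtain ⟨M, hM⟩ : ∃ M, ∀ T, 0 ≤ T → |F T| ≤ M := by
    obtain ⟨T₀, hT₀⟩ := eventually_atTop.1
      ((hL.abs).eventually (gt_mem_nhds (lt_add_one |L|)))
    obtain ⟨B, hB⟩ := (isCompact_Icc (a := (0 : ℝ)) (b := T₀)).exists_bound_of_continuousOn
      hFc.continuousOn
    refine ⟨max B (|L| + 1), fun T hT => ?_⟩
    rcases le_total T T₀ with h | h
    · exact le_max_of_le_left (hB T ⟨hT, h⟩)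
    · exact le_max_of_le_right (hT₀ T h).le
  -- After integration by parts and the substitution `s = α t`, the integral is `∫ e^{-s} F(s/α)
  -- ds`, where `F(s/α) → L` boundedly.
  have hlim : Tendsto (fun α : ℝ => ∫ s in Set.Ioi (0 : ℝ), Real.exp (-s) * F (α⁻¹ * s))
      (𝓝[>] 0) (𝓝 (∫ s in Set.Ioi (0 : ℝ), Real.exp (-s) * L)) := by
    refine tendsto_integral_filter_of_dominated_convergence (fun s => Real.exp (-s) * M)
      (Eventually.of_forall fun α => by fun_prop) ?_
      ((integrableOn_exp_neg_Ioi 0).mul_const M) ?_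
    · filter_upwards [self_mem_nhdsWithin] with α hα
      filter_upwards [ae_restrict_mem measurableSet_Ioi] with s hs
      rw [norm_mul, Real.norm_of_nonneg (Real.exp_pos _).le, Real.norm_eq_abs]
      exact mul_le_mul_of_nonneg_left
        (hM _ (mul_nonneg (inv_nonneg.2 (le_of_lt hα)) (le_of_lt hs))) (Real.exp_pos _).le
    · filter_upwards [ae_restrict_mem measurableSet_Ioi] with s hs
      exact (hL.comp (tendsto_inv_nhdsGT_zero.atTop_mul_const hs)).const_mul _
  rw [integral_mul_const, integral_exp_neg_Ioi_zero, one_mul] at hlim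
  refine hlim.congr' ?_
  filter_upwards [self_mem_nhdsWithin] with α hα
  have hα' : (0 : ℝ) < α := hα
  rw [integral_exp_neg_mul_eq_mul_integral hf hα' hC hM]
  have := integral_comp_mul_left_Ioi (fun s => Real.exp (-s) * F (α⁻¹ * s)) 0 hα'
  rw [mul_zero, smul_eq_mul] at this
  have h2 := congrArg (fun c => α * c) this
  simp only [mul_inv_cancel_left₀ hα'.ne', inv_mul_cancel_left₀ hα'.ne'] at h2
  rw [← h2]
  simp only [neg_mul, hF]

/-! ### Limits and bounds for sums. -/

/-- **Scheffé's lemma** for sums, tested against bounded functions. -/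
theorem tendsto_tsum_mul_of_tendsto_tsum {ι α : Type*} {l : Filter α} {a : α → ι → ℝ}
    {b c : ι → ℝ} (ha : ∀ᶠ s in l, 0 ≤ a s) (hb : 0 ≤ b) (hsa : ∀ s, Summable (a s))
    (hsb : Summable b) (hlim : ∀ i, Tendsto (fun s => a s i) l (𝓝 (b i)))
    (hsum : Tendsto (fun s => ∑' i, a s i) l (𝓝 (∑' i, b i))) (hc : ∀ i, |c i| ≤ 1) :
    Tendsto (fun s => ∑' i, a s i * c i) l (𝓝 (∑' i, b i * c i)) := by
  have hmul : ∀ {v : ι → ℝ}, Summable v → Summable fun i => v i * c i := fun {v} hv => by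
    refine Summable.of_norm_bounded hv.abs fun i => ?_
    rw [norm_mul]
    exact mul_le_of_le_one_right (norm_nonneg _) (hc i)
  have hmin_s : ∀ᶠ s in l, Summable fun i => min (a s i) (b i) := by
    filter_upwards [ha] with s hs
    refine Summable.of_nonneg_of_le (fun i => le_min (hs i) (hb i)) (fun i => min_le_right _ _) hsb
  have hmin : Tendsto (fun s => ∑' i, min (a s i) (b i)) l (𝓝 (∑' i, b i)) := by
    refine tendsto_tsum_of_dominated_convergence hsb (fun i => ?_) ?_
    · simpa using (hlim i).min (tendsto_const_nhds (x := b i))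
    · filter_upwards [ha] with s hs i
      rw [Real.norm_of_nonneg (le_min (hs i) (hb i))]
      exact min_le_right _ _
  -- This expression is `∑ |a - b|`, because `|a - b| = a + b - 2 min(a,b)`; the minimum is
  -- dominated by `b`.
  have hbound : Tendsto (fun s => ∑' i, a s i + ∑' i, b i - 2 * ∑' i, min (a s i) (b i)) l
      (𝓝 0) := by
    have := (hsum.add_const (∑' i, b i)).sub (hmin.const_mul 2)
    simpa [two_mul] using this
  rw [tendsto_iff_norm_sub_tendsto_zero]
  refine squeeze_zero' (Eventually.of_forall fun s => norm_nonneg _) ?_ hbound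
  filter_upwards [hmin_s] with s hs
  rw [← (hmul (hsa s)).tsum_sub (hmul hsb), ← (hsa s).tsum_add hsb, ← tsum_mul_left,
    ← ((hsa s).add hsb).tsum_sub (hs.mul_left 2)]
  refine tsum_of_norm_bounded ((((hsa s).add hsb).sub (hs.mul_left 2)).hasSum) fun i => ?_
  rw [← sub_mul, norm_mul]
  refine (mul_le_of_le_one_right (norm_nonneg _) (hc i)).trans ?_
  rw [Real.norm_eq_abs]
  rcases le_total (a s i) (b i) with h | h
  · rw [min_eq_left h, abs_of_nonpos (by linarith)]; linarith
  · rw [min_eq_right h, abs_of_nonneg (by linarith)]; linarith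

/-- A monotone sequence of nonnegative kernels with summably bounded column sums has row sums
with a common summable bound. -/
theorem exists_summable_bound_tsum_of_monotone {ι κ : Type*} {a : ℕ → ι → κ → ℝ} {c : κ → ℝ}
    (ha : ∀ n i k, 0 ≤ a n i k) (hmono : ∀ i k, Monotone fun n => a n i k) (hc : Summable c)
    (hle : ∀ n k (F : Finset ι), ∑ i ∈ F, a n i k ≤ c k) :
    ∃ B : ι → ℝ, Summable B ∧ ∀ n i, Summable (a n i) ∧ ∑' k, a n i k ≤ B i := by
  have hac : ∀ n i k, a n i k ≤ c k := fun n i k => by simpa using hle n k {i}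
  have hbdd : ∀ i k, BddAbove (Set.range fun n => a n i k) := fun i k =>
    ⟨c k, by rintro _ ⟨n, rfl⟩; exact hac n i k⟩
  -- By monotonicity the supremum is a limit, so it inherits the column bound; its row sums are the
  -- common bound.
  set b : ι → κ → ℝ := fun i k => ⨆ n, a n i k with hb
  have hab : ∀ n i k, a n i k ≤ b i k := fun n i k => le_ciSup (hbdd i k) n
  have hb0 : ∀ i k, 0 ≤ b i k := fun i k => (ha 0 i k).trans (hab 0 i k)
  have hlim : ∀ i k, Tendsto (fun n => a n i k) atTop (𝓝 (b i k)) := fun i k =>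
    tendsto_atTop_ciSup (hmono i k) (hbdd i k)
  have hcol : ∀ k (F : Finset ι), ∑ i ∈ F, b i k ≤ c k := fun k F =>
    le_of_tendsto' (tendsto_finsetSum F fun i _ => hlim i k) fun n => hle n k F
  have hc0 : ∀ k, 0 ≤ c k := fun k => by simpa using hle 0 k ∅
  have hbs : ∀ i, Summable (b i) := fun i =>
    Summable.of_nonneg_of_le (hb0 i) (fun k => by simpa using hcol k {i}) hc
  refine ⟨fun i => ∑' k, b i k, ?_, fun n i => ?_⟩
  · refine summable_of_sum_le (c := ∑' k, c k) (fun i => tsum_nonneg (hb0 i)) fun F => ?_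
    rw [← Summable.tsum_finsetSum fun i _ => hbs i]
    exact Summable.tsum_le_tsum (fun k => hcol k F) (summable_sum fun i _ => hbs i) hc
  · have : Summable (a n i) := Summable.of_nonneg_of_le (ha n i) (hac n i) hc
    exact ⟨this, this.tsum_le_tsum (hab n i) (hbs i)⟩

/-! ### Transition functions and the backward equation. -/

/-- A standard transition function `p` on a countable state space whose derivative at `0` is the
stable conservative rate matrix with off-diagonal part `r`. Negative times are identified
with time `0`. -/
structure IsConservativeTransitionFunction {S : Type*} [DecidableEq S] (p : ℝ → S → S → ℝ)
    (r : S → S → ℝ) : Prop where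
  nonneg : ∀ t x y, 0 ≤ p t x y
  hasSum_one : ∀ t x, HasSum (p t x) 1
  eq_max : ∀ t x y, p t x y = p (max t 0) x y
  zero : ∀ x y, p 0 x y = if x = y then 1 else 0
  chapman : ∀ s t, 0 ≤ s → 0 ≤ t → ∀ x z, HasSum (fun y => p s x y * p t y z) (p (s + t) x z)
  rate_nonneg : ∀ x y, 0 ≤ r x y
  rate_self : ∀ x, r x x = 0
  summable_rate : ∀ x, Summable (r x)
  jump : ∀ x y, x ≠ y → Tendsto (fun t => p t x y / t) (𝓝[>] 0) (𝓝 (r x y))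
  hold : ∀ x, Tendsto (fun t => (1 - p t x x) / t) (𝓝[>] 0) (𝓝 (∑' y, r x y))

namespace IsConservativeTransitionFunction

variable {S : Type*} [DecidableEq S] {p : ℝ → S → S → ℝ} {r : S → S → ℝ}

theorem le_one (hp : IsConservativeTransitionFunction p r) (t : ℝ) (x y : S) : p t x y ≤ 1 :=
  le_hasSum (hp.hasSum_one t x) y fun z _ => hp.nonneg t x z

theorem abs_le_one (hp : IsConservativeTransitionFunction p r) (t : ℝ) (x y : S) :
    |p t x y| ≤ 1 := by
  rw [abs_of_nonneg (hp.nonneg t x y)]; exact hp.le_one t x y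

theorem hasSum_off (hp : IsConservativeTransitionFunction p r) (t : ℝ) (x : S) :
    HasSum (fun y => if y = x then 0 else p t x y) (1 - p t x x) := by
  have h := (hp.hasSum_one t x).sub (hasSum_ite_eq x (p t x x))
  refine h.congr_fun fun y => ?_
  split_ifs with h
  · simp [h]
  · simp

theorem hasSum_sub (hp : IsConservativeTransitionFunction p r) {s t : ℝ} (hs : 0 ≤ s) (ht : 0 ≤ t)
    (x z : S) : HasSum (fun y => (if y = x then 0 else p s x y) * p t y z)
      (p (t + s) x z - p t x z + (1 - p s x x) * p t x z) := by
  have h := (hp.chapman s t hs ht x z).sub (hasSum_ite_eq x (p s x x * p t x z))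
  have e : p (t + s) x z - p t x z + (1 - p s x x) * p t x z
      = p (s + t) x z - p s x x * p t x z := by rw [add_comm s t]; ring
  rw [e]
  refine h.congr_fun fun y => ?_
  split_ifs with h
  · simp [h]
  · simp

/-- The increment is the difference of two numbers in `[0, 1 - p s x x]`: the gain from having moved
by time `s` and the loss from not having stayed. The bound does not depend on `t`, hence gives
uniform continuity in time. -/
theorem abs_sub_le (hp : IsConservativeTransitionFunction p r) {s t : ℝ} (hs : 0 ≤ s) (ht : 0 ≤ t)
    (x z : S) : |p (t + s) x z - p t x z| ≤ 1 - p s x x := by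
  have h1 := hp.hasSum_sub hs ht x z
  have h2 := hp.hasSum_off s x
  have hnn : ∀ y, 0 ≤ if y = x then 0 else p s x y := fun y => by
    split_ifs; exacts [le_rfl, hp.nonneg _ _ _]
  have hle := hasSum_le (fun y => mul_le_of_le_one_right (hnn y) (hp.le_one t y z)) h1 h2
  have hge := h1.nonneg fun y => mul_nonneg (hnn y) (hp.nonneg t y z)
  have h3 : 0 ≤ 1 - p s x x := sub_nonneg.2 (hp.le_one s x x)
  have h4 := mul_nonneg h3 (hp.nonneg t x z)
  have h5 := mul_le_of_le_one_right h3 (hp.le_one t x z)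
  rw [abs_le]
  constructor <;> linarith

theorem tendsto_hold (hp : IsConservativeTransitionFunction p r) (x : S) :
    Tendsto (fun s => 1 - p s x x) (𝓝[≥] 0) (𝓝 0) := by
  have h1 : Tendsto (fun s => 1 - p s x x) (𝓝[>] 0) (𝓝 0) := by
    have h := (hp.hold x).mul (tendsto_nhdsWithin_of_tendsto_nhds (tendsto_id (α := ℝ)) (s := Set.Ioi 0))
    rw [mul_zero] at h
    refine h.congr' ?_
    filter_upwards [self_mem_nhdsWithin] with s hs
    exact div_mul_cancel₀ _ (ne_of_gt hs)
  have h2 : (𝓝[≥] (0 : ℝ)) = 𝓝[>] 0 ⊔ pure 0 := by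
    rw [← Set.Ioi_insert, nhdsWithin_insert, sup_comm]
  rw [h2, tendsto_sup]
  refine ⟨h1, ?_⟩
  rw [tendsto_pure_left]
  intro s hs
  simpa [hp.zero] using mem_of_mem_nhds hs

theorem abs_sub_le_abs (hp : IsConservativeTransitionFunction p r) {s t : ℝ} (hs : 0 ≤ s)
    (ht : 0 ≤ t) (x z : S) : |p t x z - p s x z| ≤ 1 - p |t - s| x x := by
  rcases le_total s t with hst | hst
  · rw [abs_of_nonneg (sub_nonneg.2 hst)]
    simpa using hp.abs_sub_le (sub_nonneg.2 hst) hs x z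
  · rw [abs_sub_comm, abs_sub_comm t s, abs_of_nonneg (sub_nonneg.2 hst)]
    simpa using hp.abs_sub_le (sub_nonneg.2 hst) ht x z

theorem continuous (hp : IsConservativeTransitionFunction p r) (x z : S) :
    Continuous fun t => p t x z := by
  refine continuous_iff_continuousAt.2 fun s => ?_
  rw [ContinuousAt, tendsto_iff_norm_sub_tendsto_zero]
  have h0 : Tendsto (fun t => |max t 0 - max s 0|) (𝓝 s) (𝓝[≥] 0) := by
    refine tendsto_nhdsWithin_iff.2 ⟨?_, Eventually.of_forall fun t => Set.mem_Ici.2 (abs_nonneg _)⟩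
    have : Continuous fun t => |max t 0 - max s 0| := by fun_prop
    simpa using this.tendsto s
  refine squeeze_zero (fun t => norm_nonneg _) (fun t => ?_) ((hp.tendsto_hold x).comp h0)
  rw [hp.eq_max t, hp.eq_max s, Real.norm_eq_abs]
  exact hp.abs_sub_le_abs (le_max_right _ _) (le_max_right _ _) x z

theorem summable_rate_mul (hp : IsConservativeTransitionFunction p r) (x : S) {c : S → ℝ} {C : ℝ}
    (hc : ∀ y, |c y| ≤ C) : Summable fun y => r x y * c y := by
  refine Summable.of_norm_bounded ((hp.summable_rate x).mul_right C) fun y => ?_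
  rw [norm_mul, Real.norm_of_nonneg (hp.rate_nonneg x y)]
  exact mul_le_mul_of_nonneg_left (hc y) (hp.rate_nonneg x y)

theorem continuous_tsum_rate_mul (hp : IsConservativeTransitionFunction p r) (x z : S) :
    Continuous fun t => ∑' y, r x y * p t y z := by
  refine continuous_tsum (fun y => (hp.continuous y z).const_mul _) (hp.summable_rate x)
    fun y t => ?_
  rw [norm_mul, Real.norm_of_nonneg (hp.rate_nonneg x y), Real.norm_eq_abs]
  exact mul_le_of_le_one_right (hp.rate_nonneg x y) (hp.abs_le_one t y z)

/-- Kolmogorov's backward equation, as a right derivative. -/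
theorem hasDerivWithinAt (hp : IsConservativeTransitionFunction p r) {t : ℝ} (ht : 0 ≤ t)
    (x z : S) : HasDerivWithinAt (fun t => p t x z)
      (∑' y, r x y * p t y z - (∑' y, r x y) * p t x z) (Set.Ioi t) t := by
  -- Scheffé applies because the total off-diagonal mass is `(1 - p s x x) / s`, which converges to
  -- the sum of the rates.
  have hlim : Tendsto (fun s => ∑' y, (if y = x then 0 else p s x y) / s * p t y z) (𝓝[>] 0)
      (𝓝 (∑' y, r x y * p t y z)) := by
    refine tendsto_tsum_mul_of_tendsto_tsum ?_ (hp.rate_nonneg x)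
      (fun s => (hp.hasSum_off s x).summable.div_const s) (hp.summable_rate x) (fun y => ?_) ?_
      (fun y => hp.abs_le_one t y z)
    · filter_upwards [self_mem_nhdsWithin] with s hs y
      refine div_nonneg ?_ (le_of_lt hs)
      split_ifs; exacts [le_rfl, hp.nonneg _ _ _]
    · split_ifs with h
      · simp [h, hp.rate_self]
      · exact hp.jump x y (Ne.symm h)
    · refine (hp.hold x).congr fun s => ?_
      rw [tsum_div_const, (hp.hasSum_off s x).tsum_eq]
  rw [hasDerivWithinAt_iff_tendsto_slope' (by simp)]
  have h1 := hlim.sub ((hp.hold x).mul_const (p t x z))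
  have hmap : Tendsto (fun u => u - t) (𝓝[>] t) (𝓝[>] 0) := by
    refine tendsto_nhdsWithin_iff.2 ⟨?_, ?_⟩
    · have : Continuous fun u : ℝ => u - t := by fun_prop
      simpa using (this.tendsto t).mono_left nhdsWithin_le_nhds
    · filter_upwards [self_mem_nhdsWithin] with u hu using Set.mem_Ioi.2 (sub_pos.2 hu)
  refine (h1.comp hmap).congr' ?_
  filter_upwards [self_mem_nhdsWithin] with u hu
  have hu' : 0 < u - t := sub_pos.2 hu
  have h2 := (hp.hasSum_sub hu'.le ht x z).tsum_eq
  simp only [Function.comp_apply, div_mul_eq_mul_div, tsum_div_const, h2, slope_def_field]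
  rw [add_sub_cancel, ← sub_div]
  congr 1
  ring

/-- The integrated backward equation, with a discount rate. -/
theorem hasSum_rate_mul_intervalIntegral [Countable S]
    (hp : IsConservativeTransitionFunction p r) (α : ℝ) {T : ℝ} (hT : 0 ≤ T) (x z : S) :
    HasSum (fun y => r x y * ∫ t in (0 : ℝ)..T, Real.exp (-α * t) * p t y z)
      (Real.exp (-α * T) * p T x z - (if x = z then 1 else 0)
        + (∑' y, r x y + α) * ∫ t in (0 : ℝ)..T, Real.exp (-α * t) * p t x z) := by
  have hc := hp.continuous
  have hcr := hp.continuous_tsum_rate_mul x z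
  -- A right derivative is enough here, since the function is continuous and the derivative
  -- integrable.
  have hftc := intervalIntegral.integral_eq_sub_of_hasDeriv_right (a := 0) (b := T)
    (f := fun t => Real.exp (-α * t) * p t x z)
    (f' := fun t => Real.exp (-α * t) * (∑' y, r x y * p t y z)
      - (∑' y, r x y + α) * (Real.exp (-α * t) * p t x z))
    (by have := hc x z; fun_prop)
    (fun t ht => by
      rw [min_eq_left hT] at ht
      have hexp : HasDerivAt (fun t => Real.exp (-α * t)) (-α * Real.exp (-α * t)) t := by
        have := ((hasDerivAt_id t).const_mul (-α)).exp
        simpa [mul_comm] using this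
      refine (hexp.hasDerivWithinAt.mul (hp.hasDerivWithinAt ht.1.le x z)).congr_deriv ?_
      ring)
    (by
      refine Continuous.intervalIntegrable ?_ _ _
      have := hc x z
      fun_prop)
  have hsplit := intervalIntegral.integral_sub (μ := volume) (a := (0 : ℝ)) (b := T)
    (f := fun t => Real.exp (-α * t) * (∑' y, r x y * p t y z))
    (g := fun t => (∑' y, r x y + α) * (Real.exp (-α * t) * p t x z))
    (Continuous.intervalIntegrable (by fun_prop) _ _)
    (Continuous.intervalIntegrable (by have := hc x z; fun_prop) _ _)
  rw [hsplit, intervalIntegral.integral_const_mul] at hftc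
  have hswap := hasSum_integral_of_sum_norm_le (μ := volume.restrict (Set.Ioc 0 T))
    (f := fun y t => r x y * (Real.exp (-α * t) * p t y z))
    (bound := fun t => (∑' y, r x y) * Real.exp (-α * t))
    (fun y => by have := hc y z; exact Continuous.aestronglyMeasurable (by fun_prop))
    (by
      have : Continuous fun t => (∑' y, r x y) * Real.exp (-α * t) := by fun_prop
      exact this.integrableOn_Ioc)
    (ae_of_all _ fun t F => by
      have h1 : ∀ y ∈ F, ‖r x y * (Real.exp (-α * t) * p t y z)‖
          ≤ r x y * Real.exp (-α * t) := fun y _ => by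
        rw [norm_mul, norm_mul, Real.norm_of_nonneg (hp.rate_nonneg x y),
          Real.norm_of_nonneg (Real.exp_pos _).le, Real.norm_eq_abs]
        exact mul_le_mul_of_nonneg_left
          (mul_le_of_le_one_right (Real.exp_pos _).le (hp.abs_le_one t y z)) (hp.rate_nonneg x y)
      refine (Finset.sum_le_sum h1).trans ?_
      rw [← Finset.sum_mul]
      exact mul_le_mul_of_nonneg_right
        ((hp.summable_rate x).sum_le_tsum F fun y _ => hp.rate_nonneg x y) (Real.exp_pos _).le)
  simp only [← intervalIntegral.integral_of_le hT, intervalIntegral.integral_const_mul] at hswap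
  convert hswap using 1
  have e : (fun t => ∑' y, r x y * (Real.exp (-α * t) * p t y z))
      = fun t => Real.exp (-α * t) * (∑' y, r x y * p t y z) := by
    funext t
    rw [← tsum_mul_left]
    congr 1 with y
    ring
  rw [e]
  simp only [mul_zero, Real.exp_zero, one_mul, hp.zero] at hftc
  linarith

end IsConservativeTransitionFunction

/-! ### Resolvents. -/

noncomputable section

/-- The resolvent (Laplace transform) of a transition function. -/
def transitionResolvent {S : Type*} (p : ℝ → S → S → ℝ) (α : ℝ) (y z : S) : ℝ :=
  ∫ t in Set.Ioi (0 : ℝ), Real.exp (-α * t) * p t y z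

namespace IsConservativeTransitionFunction

variable {S : Type*} [DecidableEq S] {p : ℝ → S → S → ℝ} {r : S → S → ℝ}

local notation "R" => transitionResolvent p

theorem resolvent_nonneg (hp : IsConservativeTransitionFunction p r) (α : ℝ) (y z : S) :
    0 ≤ R α y z :=
  integral_nonneg fun t => mul_nonneg (Real.exp_pos _).le (hp.nonneg t y z)

theorem integrableOn_resolvent (hp : IsConservativeTransitionFunction p r) {α : ℝ} (hα : 0 < α)
    (y z : S) : IntegrableOn (fun t => Real.exp (-α * t) * p t y z) (Set.Ioi 0) :=
  integrableOn_exp_neg_mul_of_bounded (hp.continuous y z) hα fun t _ => hp.abs_le_one t y z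

/-- Exchange of a Laplace transform and a boundedly convergent sum. -/
theorem hasSum_mul_resolvent [Countable S] (hp : IsConservativeTransitionFunction p r) {ι : Type*}
    [Countable ι] {α : ℝ} (hα : 0 < α) (y z : ι → S) (c : ι → ℝ) {C : ℝ}
    (hC : ∀ t, 0 ≤ t → ∀ F : Finset ι, ∑ i ∈ F, |c i| * p t (y i) (z i) ≤ C) :
    HasSum (fun i => c i * R α (y i) (z i))
      (∫ t in Set.Ioi (0 : ℝ), Real.exp (-α * t) * ∑' i, c i * p t (y i) (z i)) := by
  have h := hasSum_integral_of_sum_norm_le (μ := volume.restrict (Set.Ioi 0))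
    (f := fun i t => c i * (Real.exp (-α * t) * p t (y i) (z i)))
    (bound := fun t => Real.exp (-α * t) * C)
    (fun i => by
      have := hp.continuous (y i) (z i)
      exact Continuous.aestronglyMeasurable (by fun_prop))
    ((exp_neg_integrableOn_Ioi 0 hα).mul_const C)
    (by
      filter_upwards [ae_restrict_mem measurableSet_Ioi] with t ht F
      have e : ∀ i ∈ F, ‖c i * (Real.exp (-α * t) * p t (y i) (z i))‖
          = Real.exp (-α * t) * (|c i| * p t (y i) (z i)) := fun i _ => by
        rw [norm_mul, norm_mul, Real.norm_of_nonneg (hp.nonneg _ _ _),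
          Real.norm_of_nonneg (Real.exp_pos _).le, Real.norm_eq_abs]
        ring
      rw [Finset.sum_congr rfl e, ← Finset.mul_sum]
      exact mul_le_mul_of_nonneg_left (hC t (le_of_lt ht) F) (Real.exp_pos _).le)
  simp only [integral_const_mul] at h
  have e : (fun t => Real.exp (-α * t) * ∑' i, c i * p t (y i) (z i))
      = fun t => ∑' i, c i * (Real.exp (-α * t) * p t (y i) (z i)) := by
    funext t
    rw [← tsum_mul_left]
    refine tsum_congr fun i => ?_
    ring
  rw [e]
  exact h

theorem hasSum_resolvent [Countable S] (hp : IsConservativeTransitionFunction p r) {α : ℝ}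
    (hα : 0 < α) (y : S) : HasSum (fun z => R α y z) α⁻¹ := by
  have h := hp.hasSum_mul_resolvent hα (fun _ => y) (fun z => z) (fun _ => 1) (C := 1)
    fun t _ F => by
      simpa using sum_le_hasSum F (fun z _ => hp.nonneg t y z) (hp.hasSum_one t y)
  simpa [(hp.hasSum_one _ y).tsum_eq, integral_exp_neg_mul_Ioi hα, ← neg_mul] using h

theorem resolvent_le [Countable S] (hp : IsConservativeTransitionFunction p r) {α : ℝ}
    (hα : 0 < α) (y z : S) : R α y z ≤ α⁻¹ :=
  le_hasSum (hp.hasSum_resolvent hα y) z fun w _ => hp.resolvent_nonneg α y w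

theorem sum_mul_le_of_forall_le (hp : IsConservativeTransitionFunction p r) (t : ℝ) (y : S)
    {c : S → ℝ} {C : ℝ} (hc : ∀ w, c w ≤ C) (hC : 0 ≤ C) (F : Finset S) :
    ∑ w ∈ F, c w * p t y w ≤ C := by
  calc ∑ w ∈ F, c w * p t y w ≤ ∑ w ∈ F, C * p t y w :=
        Finset.sum_le_sum fun w _ => mul_le_mul_of_nonneg_right (hc w) (hp.nonneg t y w)
    _ = C * ∑ w ∈ F, p t y w := by rw [Finset.mul_sum]
    _ ≤ C := mul_le_of_le_one_right hC
        (sum_le_hasSum F (fun z _ => hp.nonneg t y z) (hp.hasSum_one t y))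

/-- The resolvent form of the backward equation. -/
theorem hasSum_rate_mul_resolvent [Countable S] (hp : IsConservativeTransitionFunction p r)
    {α : ℝ} (hα : 0 < α) (x z : S) :
    HasSum (fun y => r x y * R α y z)
      ((∑' y, r x y + α) * R α x z - if x = z then 1 else 0) := by
  have hR : ∀ y, Tendsto (fun T => ∫ t in (0 : ℝ)..T, Real.exp (-α * t) * p t y z) atTop
      (𝓝 (R α y z)) := fun y =>
    intervalIntegral_tendsto_integral_Ioi 0 (hp.integrableOn_resolvent hα y z) tendsto_id
  have hs : Summable fun y => r x y * R α y z := hp.summable_rate_mul x fun y => by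
    rw [abs_of_nonneg (hp.resolvent_nonneg α y z)]; exact hp.resolvent_le hα y z
  have h1 : Tendsto (fun T => ∑' y, r x y * ∫ t in (0 : ℝ)..T, Real.exp (-α * t) * p t y z)
      atTop (𝓝 (∑' y, r x y * R α y z)) := by
    refine tendsto_tsum_of_dominated_convergence ((hp.summable_rate x).mul_right α⁻¹)
      (fun y => (hR y).const_mul _) ?_
    filter_upwards [eventually_ge_atTop 0] with T hT y
    rw [norm_mul, Real.norm_of_nonneg (hp.rate_nonneg x y), Real.norm_of_nonneg
      (intervalIntegral.integral_nonneg hT fun t _ =>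
        mul_nonneg (Real.exp_pos _).le (hp.nonneg t y z))]
    refine mul_le_mul_of_nonneg_left (le_trans ?_ (hp.resolvent_le hα y z)) (hp.rate_nonneg x y)
    rw [intervalIntegral.integral_of_le hT]
    exact setIntegral_mono_set (hp.integrableOn_resolvent hα y z)
      (ae_of_all _ fun t => mul_nonneg (Real.exp_pos _).le (hp.nonneg t y z))
      (ae_of_all _ fun t ht => Set.Ioc_subset_Ioi_self ht)
  -- Let `T → ∞` in the integrated equation; the boundary term `e^{-αT} p_T(x,z)` vanishes.
  have h2 : Tendsto (fun T => ∑' y, r x y * ∫ t in (0 : ℝ)..T, Real.exp (-α * t) * p t y z)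
      atTop (𝓝 (0 - (if x = z then 1 else 0) + (∑' y, r x y + α) * R α x z)) := by
    refine (((tendsto_exp_neg_mul_mul_of_bounded hα fun t _ => hp.abs_le_one t x z).sub_const
      (if x = z then 1 else 0)).add ((hR x).const_mul (∑' y, r x y + α))).congr' ?_
    filter_upwards [eventually_ge_atTop 0] with T hT
    exact (hp.hasSum_rate_mul_intervalIntegral α hT x z).tsum_eq.symm
  have h3 := hs.hasSum
  rw [tendsto_nhds_unique h1 h2] at h3
  convert h3 using 1
  ring

/-- The resolvent equation between the parameters `1` and `α`. -/
theorem hasSum_resolvent_mul_resolvent [Countable S] (hp : IsConservativeTransitionFunction p r)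
    {α : ℝ} (hα : 0 < α) (hα1 : α < 1) (y z : S) :
    HasSum (fun w => R 1 y w * R α w z) ((R α y z - R 1 y z) / (1 - α)) := by
  have hb : 0 < 1 - α := sub_pos.2 hα1
  set f : ℝ → ℝ := fun t => Real.exp (-α * t) * p t y z with hf
  have hfc : Continuous f := by have := hp.continuous y z; fun_prop
  have hf0 : ∀ t, 0 ≤ f t := fun t => mul_nonneg (Real.exp_pos _).le (hp.nonneg t y z)
  have hfi : IntegrableOn f (Set.Ioi 0) := hp.integrableOn_resolvent hα y z
  set J : ℝ → ℝ := fun T => ∫ t in (0 : ℝ)..T, f t with hJ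
  have hJc : Continuous J := intervalIntegral.continuous_primitive
    (fun a b => hfc.intervalIntegrable a b) 0
  have hJle : ∀ T, 0 ≤ T → |J T| ≤ R α y z := fun T hT => by
    rw [abs_of_nonneg (intervalIntegral.integral_nonneg hT fun t _ => hf0 t),
      intervalIntegral.integral_of_le hT]
    exact setIntegral_mono_set hfi (ae_of_all _ hf0)
      (ae_of_all _ fun t ht => Set.Ioc_subset_Ioi_self ht)
  -- `∑ w, p s y w * R α w z = e^{αs} (R α y z - J s)`
  have hV : ∀ s, 0 ≤ s → HasSum (fun w => p s y w * R α w z)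
      (Real.exp (α * s) * (R α y z - J s)) := fun s hs => by
    have h := hp.hasSum_mul_resolvent hα (fun w => w) (fun _ => z) (fun w => p s y w) (C := 1)
      fun t ht F => by
        simp_rw [abs_of_nonneg (hp.nonneg s y _)]
        exact (sum_le_hasSum F (fun w _ => mul_nonneg (hp.nonneg s y w) (hp.nonneg t w z))
          (hp.chapman s t hs ht y z)).trans (hp.le_one _ _ _)
    convert h using 1
    have e1 : ∫ t in Set.Ioi (0 : ℝ), Real.exp (-α * t) * ∑' w, p s y w * p t w z
        = ∫ t in Set.Ioi (0 : ℝ), Real.exp (α * s) * f (t + s) := by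
      refine setIntegral_congr_fun measurableSet_Ioi fun t ht => ?_
      simp only [hf]
      rw [(hp.chapman s t hs (le_of_lt ht) y z).tsum_eq, ← mul_assoc, ← Real.exp_add, add_comm t s]
      congr 2
      ring
    have e4 : ∫ t in Set.Ioi (0 : ℝ), f (t + s) = ∫ t in Set.Ioi s, f t := by
      have := (measurePreserving_add_right volume s).setIntegral_preimage_emb
        (measurableEmbedding_addRight s) f (Set.Ioi s)
      simpa using this
    rw [e1, integral_const_mul, e4]
    congr 1
    have e5 := intervalIntegral.integral_Ioi_sub_Ioi hfi hs
    have e6 : R α y z = ∫ t in Set.Ioi (0 : ℝ), f t := rfl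
    have e7 : J s = ∫ t in (0 : ℝ)..s, f t := rfl
    linarith
  have h := hp.hasSum_mul_resolvent one_pos (fun _ => y) (fun w => w) (fun w => R α w z)
    (C := α⁻¹) fun t _ F => hp.sum_mul_le_of_forall_le t y
      (fun w => by rw [abs_of_nonneg (hp.resolvent_nonneg α w z)]; exact hp.resolvent_le hα w z)
      (inv_nonneg.2 hα.le) F
  convert h using 1
  · funext w; ring
  have e2 : ∫ t in Set.Ioi (0 : ℝ), Real.exp (-1 * t) * ∑' w, R α w z * p t y w
      = ∫ t in Set.Ioi (0 : ℝ), (Real.exp (-(1 - α) * t) * R α y z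
          - Real.exp (-(1 - α) * t) * J t) := by
    refine setIntegral_congr_fun measurableSet_Ioi fun t ht => ?_
    simp only [mul_comm (R α _ z)]
    rw [(hV t (le_of_lt ht)).tsum_eq, ← mul_assoc, ← Real.exp_add, ← mul_sub]
    congr 2
    ring
  rw [e2, integral_sub ((exp_neg_integrableOn_Ioi 0 hb).mul_const _)
    (integrableOn_exp_neg_mul_of_bounded hJc hb hJle), integral_mul_const,
    integral_exp_neg_mul_Ioi hb]
  -- `J` is the primitive of `e^{-αt} p_t(y,z)`, so a further discount `1 - α` turns its Laplace
  -- integral into `R_1 / (1 - α)`.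
  have hibp := integral_exp_neg_mul_eq_mul_integral hfc (C := 1) (M := R α y z) hb
    (fun t ht => by
      rw [abs_of_nonneg (hf0 t)]
      exact mul_le_one₀ (Real.exp_le_one_iff.2 (by nlinarith)) (hp.nonneg t y z) (hp.le_one t y z))
    hJle
  have e3 : ∫ t in Set.Ioi (0 : ℝ), Real.exp (-(1 - α) * t) * f t = R 1 y z := by
    refine setIntegral_congr_fun measurableSet_Ioi fun t _ => ?_
    simp only [hf]
    rw [← mul_assoc, ← Real.exp_add]
    congr 2
    ring
  rw [e3] at hibp
  change _ = (1 - α)⁻¹ * R α y z - ∫ t in Set.Ioi (0 : ℝ), Real.exp (-(1 - α) * t) * J t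
  rw [hibp]
  field_simp
  rfl

end IsConservativeTransitionFunction

/-! ### Green kernels and first passage. -/

/-- Minimum principle: a bounded function that is nonnegative at `x` and, off `x`, superharmonic
for a strictly discounted stochastic kernel is nonnegative. -/
theorem nonneg_of_superharmonic_off {S : Type*} {K : S → S → ℝ} (hK : ∀ y w, 0 ≤ K y w)
    (hK1 : ∀ y, HasSum (K y) 1) {s : ℝ} (hs0 : 0 ≤ s) (hs1 : s < 1) {f : S → ℝ} {B : ℝ}
    (hB : ∀ y, |f y| ≤ B) {x : S} (hx : 0 ≤ f x)
    (hf : ∀ y, y ≠ x → s * ∑' w, K y w * f w ≤ f y) (y : S) : 0 ≤ f y := by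
  have : Nonempty S := ⟨x⟩
  have hbdd : BddBelow (Set.range f) := ⟨-B, by rintro _ ⟨w, rfl⟩; exact (abs_le.1 (hB w)).1⟩
  set m := ⨅ w, f w with hm
  have hmf : ∀ w, m ≤ f w := fun w => ciInf_le hbdd w
  by_contra! hy
  have hm0 : m < 0 := (hmf y).trans_lt hy
  have hsum : ∀ y, Summable fun w => K y w * f w := fun y => by
    refine Summable.of_norm_bounded ((hK1 y).summable.mul_right B) fun w => ?_
    rw [norm_mul, Real.norm_of_nonneg (hK y w)]
    exact mul_le_mul_of_nonneg_left (hB w) (hK y w)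
  -- The infimum need not be attained: `s * m` is shown to be a lower bound for every value, which
  -- contradicts `m < 0` and `s < 1`.
  have hle : s * m ≤ m := by
    refine le_ciInf fun w => ?_
    by_cases hw : w = x
    · rw [hw]; exact (mul_nonpos_of_nonneg_of_nonpos hs0 hm0.le).trans hx
    · refine le_trans (mul_le_mul_of_nonneg_left ?_ hs0) (hf w hw)
      have := hasSum_le (fun v => mul_le_mul_of_nonneg_left (hmf v) (hK w v))
        ((hK1 w).mul_right m) (hsum w).hasSum
      simpa using this
  nlinarith

theorem hasSum_of_summable_prod {ι κ : Type*} {F : ι → κ → ℝ}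
    (hF : Summable fun q : ι × κ => F q.1 q.2) {c : ι → ℝ} {d : κ → ℝ} {s : ℝ}
    (hc : ∀ i, HasSum (F i) (c i)) (hd : ∀ k, HasSum (fun i => F i k) (d k))
    (hs : HasSum c s) : HasSum d s := by
  have h1 := hF.hasSum.prod_fiberwise hc
  have h2 : HasSum (fun q : κ × ι => F q.2 q.1) (∑' q : ι × κ, F q.1 q.2) :=
    (Equiv.prodComm κ ι).hasSum_iff.2 hF.hasSum
  have h3 := h2.prod_fiberwise hd
  rwa [h1.unique hs] at h3

/-- The Green kernel `1 + (1 - α) R_α` of the time-one resolvent with discount `1 - α`. -/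
def greenKernel {S : Type*} [DecidableEq S] (p : ℝ → S → S → ℝ) (α : ℝ) (y z : S) : ℝ :=
  (if y = z then 1 else 0) + (1 - α) * transitionResolvent p α y z

/-- The Green kernel of the chain killed when it hits `x`. -/
def tabooKernel {S : Type*} [DecidableEq S] (p : ℝ → S → S → ℝ) (α : ℝ) (x y z : S) : ℝ :=
  greenKernel p α y z - greenKernel p α y x * (greenKernel p α x z / greenKernel p α x x)

/-- The part of the resolvent that avoids `x`. -/
def tabooResolvent {S : Type*} [DecidableEq S] (p : ℝ → S → S → ℝ) (α : ℝ) (x y z : S) : ℝ :=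
  transitionResolvent p α y z
    - transitionResolvent p α y x * (greenKernel p α x z / greenKernel p α x x)

namespace IsConservativeTransitionFunction

variable {S : Type*} [DecidableEq S] {p : ℝ → S → S → ℝ} {r : S → S → ℝ}

local notation "R" => transitionResolvent p
local notation "G" => greenKernel p

theorem greenKernel_nonneg (hp : IsConservativeTransitionFunction p r) {α : ℝ} (hα1 : α < 1)
    (y z : S) : 0 ≤ G α y z := by
  refine add_nonneg (by split_ifs <;> norm_num)
    (mul_nonneg (sub_nonneg.2 hα1.le) (hp.resolvent_nonneg α y z))

theorem one_le_greenKernel (hp : IsConservativeTransitionFunction p r) {α : ℝ} (hα1 : α < 1)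
    (x : S) : 1 ≤ G α x x := by
  have := mul_nonneg (sub_nonneg.2 hα1.le) (hp.resolvent_nonneg α x x)
  simp only [greenKernel, if_true]
  linarith

theorem greenKernel_le [Countable S] (hp : IsConservativeTransitionFunction p r) {α : ℝ}
    (hα : 0 < α) (hα1 : α < 1) (y z : S) : G α y z ≤ α⁻¹ := by
  have h1 := mul_le_mul_of_nonneg_left (hp.resolvent_le hα y z) (sub_nonneg.2 hα1.le)
  have h2 : (if y = z then (1 : ℝ) else 0) ≤ 1 := by split_ifs <;> norm_num
  have h3 : (1 - α) * α⁻¹ = α⁻¹ - 1 := by field_simp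
  simp only [greenKernel]
  linarith

theorem hasSum_resolvent_mul_greenKernel [Countable S] (hp : IsConservativeTransitionFunction p r)
    {α : ℝ} (hα : 0 < α) (hα1 : α < 1) (y z : S) :
    HasSum (fun w => R 1 y w * G α w z) (R α y z) := by
  have hb : 1 - α ≠ 0 := (sub_pos.2 hα1).ne'
  have h := (hasSum_ite_eq z (R 1 y z)).add
    ((hp.hasSum_resolvent_mul_resolvent hα hα1 y z).mul_left (1 - α))
  rw [mul_div_cancel₀ _ hb, add_sub_cancel] at h
  refine h.congr_fun fun w => ?_
  simp only [greenKernel]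
  split_ifs with hw
  · rw [hw]; ring
  · ring

theorem hasSum_resolvent_one [Countable S] (hp : IsConservativeTransitionFunction p r) (y : S) :
    HasSum (R 1 y) 1 := by simpa using hp.hasSum_resolvent one_pos y

/-- Off `x`, the function `G(·,x)` is harmonic for the discounted kernel while the constant `G(x,x)`
is superharmonic, so the minimum principle applies to their difference. The quotient `G(y,x)/G(x,x)`
plays the role of a discounted hitting probability. -/
theorem greenKernel_le_diag [Countable S] (hp : IsConservativeTransitionFunction p r)
    {α : ℝ} (hα : 0 < α) (hα1 : α < 1) (x y : S) : G α y x ≤ G α x x := by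
  refine sub_nonneg.1 (nonneg_of_superharmonic_off (K := R 1) (s := 1 - α) (x := x)
    (f := fun y => G α x x - G α y x) (B := α⁻¹) (hp.resolvent_nonneg 1) hp.hasSum_resolvent_one
    (sub_nonneg.2 hα1.le) (by linarith) (fun y => ?_) (by simp) (fun y hy => ?_) y)
  · have h1 := hp.greenKernel_le hα hα1 x x
    have h2 := hp.greenKernel_le hα hα1 y x
    have h3 := hp.greenKernel_nonneg hα1 y x
    have h4 := hp.greenKernel_nonneg hα1 x x
    rw [abs_le]; constructor <;> linarith
  · have h := ((hp.hasSum_resolvent_one y).mul_right (G α x x)).sub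
      (hp.hasSum_resolvent_mul_greenKernel hα hα1 y x)
    simp only [← mul_sub, one_mul] at h
    rw [h.tsum_eq]
    have h3 := hp.greenKernel_nonneg hα1 x x
    have e : G α y x = (1 - α) * R α y x := by simp [greenKernel, hy]
    rw [e]
    nlinarith

theorem hasSum_resolvent_mul_tabooKernel [Countable S] (hp : IsConservativeTransitionFunction p r)
    {α : ℝ} (hα : 0 < α) (hα1 : α < 1) (x y z : S) :
    HasSum (fun w => R 1 y w * tabooKernel p α x w z) (tabooResolvent p α x y z) := by
  have h := (hp.hasSum_resolvent_mul_greenKernel hα hα1 y z).sub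
    ((hp.hasSum_resolvent_mul_greenKernel hα hα1 y x).mul_right (G α x z / G α x x))
  refine h.congr_fun fun w => ?_
  simp only [tabooKernel]
  ring

theorem tabooKernel_eq {α : ℝ} {x y : S} (hy : y ≠ x) (z : S) :
    tabooKernel p α x y z = (if y = z then 1 else 0) + (1 - α) * tabooResolvent p α x y z := by
  have e : G α y x = (1 - α) * R α y x := by simp [greenKernel, hy]
  rw [tabooKernel, e, tabooResolvent, greenKernel]
  ring

theorem tabooKernel_self (hp : IsConservativeTransitionFunction p r) {α : ℝ} (hα1 : α < 1)
    (x z : S) : tabooKernel p α x x z = 0 := by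
  have := hp.one_le_greenKernel hα1 x
  rw [tabooKernel, mul_div_cancel₀ _ (by linarith), sub_self]

theorem abs_tabooKernel_le [Countable S] (hp : IsConservativeTransitionFunction p r)
    {α : ℝ} (hα : 0 < α) (hα1 : α < 1) (x y z : S) : |tabooKernel p α x y z| ≤ α⁻¹ := by
  have h0 := hp.one_le_greenKernel hα1 x
  have h1 := hp.greenKernel_le hα hα1 y z
  have h2 := hp.greenKernel_nonneg hα1 y z
  have h3 := hp.greenKernel_nonneg hα1 x z
  have h4 := hp.greenKernel_le hα hα1 x z
  have h5 : G α y x / G α x x ≤ 1 := div_le_one_of_le₀ (hp.greenKernel_le_diag hα hα1 x y)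
    (by linarith)
  have h6 : 0 ≤ G α y x / G α x x := div_nonneg (hp.greenKernel_nonneg hα1 y x) (by linarith)
  have e : G α y x * (G α x z / G α x x) = G α y x / G α x x * G α x z := by ring
  have h7 := mul_le_of_le_one_left h3 h5
  have h8 := mul_nonneg h6 h3
  rw [tabooKernel, e, abs_le]
  constructor <;> linarith

/-- The kernel vanishes at `x`, and off `x` it solves the discounted equation with a nonnegative
unit source at `z`. -/
theorem tabooKernel_nonneg [Countable S] (hp : IsConservativeTransitionFunction p r)
    {α : ℝ} (hα : 0 < α) (hα1 : α < 1) (x y z : S) : 0 ≤ tabooKernel p α x y z := by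
  refine nonneg_of_superharmonic_off (K := R 1) (s := 1 - α) (x := x)
    (f := fun y => tabooKernel p α x y z) (B := α⁻¹) (hp.resolvent_nonneg 1)
    hp.hasSum_resolvent_one (sub_nonneg.2 hα1.le) (by linarith)
    (fun y => hp.abs_tabooKernel_le hα hα1 x y z) (hp.tabooKernel_self hα1 x z).ge
    (fun y hy => ?_) y
  rw [(hp.hasSum_resolvent_mul_tabooKernel hα hα1 x y z).tsum_eq, tabooKernel_eq hy]
  have : (0 : ℝ) ≤ if y = z then 1 else 0 := by split_ifs <;> norm_num
  linarith

theorem tabooResolvent_nonneg [Countable S] (hp : IsConservativeTransitionFunction p r)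
    {α : ℝ} (hα : 0 < α) (hα1 : α < 1) (x y z : S) : 0 ≤ tabooResolvent p α x y z :=
  (hp.hasSum_resolvent_mul_tabooKernel hα hα1 x y z).nonneg fun w =>
    mul_nonneg (hp.resolvent_nonneg 1 y w) (hp.tabooKernel_nonneg hα hα1 x w z)

/-- The difference vanishes at `x`. Off `x` it is superharmonic for the discount `1 - α`, with
excess `(β - α)` times the nonnegative taboo resolvent at `β`. -/
theorem tabooKernel_anti [Countable S] (hp : IsConservativeTransitionFunction p r)
    {α β : ℝ} (hα : 0 < α) (hαβ : α ≤ β) (hβ1 : β < 1) (x y z : S) :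
    tabooKernel p β x y z ≤ tabooKernel p α x y z := by
  have hα1 := hαβ.trans_lt hβ1
  have hβ := hα.trans_le hαβ
  refine sub_nonneg.1 (nonneg_of_superharmonic_off (K := R 1) (s := 1 - α) (x := x)
    (f := fun y => tabooKernel p α x y z - tabooKernel p β x y z) (B := α⁻¹ + β⁻¹)
    (hp.resolvent_nonneg 1) hp.hasSum_resolvent_one (sub_nonneg.2 hα1.le) (by linarith)
    (fun y => (abs_sub _ _).trans (add_le_add (hp.abs_tabooKernel_le hα hα1 x y z)
      (hp.abs_tabooKernel_le hβ hβ1 x y z)))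
    (by simp [hp.tabooKernel_self hα1, hp.tabooKernel_self hβ1]) (fun y hy => ?_) y)
  have h := (hp.hasSum_resolvent_mul_tabooKernel hα hα1 x y z).sub
    (hp.hasSum_resolvent_mul_tabooKernel hβ hβ1 x y z)
  simp only [← mul_sub] at h
  rw [h.tsum_eq, tabooKernel_eq hy, tabooKernel_eq hy]
  nlinarith [hp.tabooResolvent_nonneg hβ hβ1 x y z]

theorem tabooResolvent_anti [Countable S] (hp : IsConservativeTransitionFunction p r)
    {α β : ℝ} (hα : 0 < α) (hαβ : α ≤ β) (hβ1 : β < 1) {x y : S} (hy : y ≠ x) (z : S) :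
    (1 - β) * tabooResolvent p β x y z ≤ (1 - α) * tabooResolvent p α x y z := by
  have h := hp.tabooKernel_anti hα hαβ hβ1 x y z
  rw [tabooKernel_eq hy, tabooKernel_eq hy] at h
  linarith

/-- Combining the backward equations for the columns `z` and `x` cancels the large terms. The sum
equals the bound when `z ≠ x` and is zero when `z = x`. -/
theorem sum_rate_mul_tabooResolvent_le [Countable S] (hp : IsConservativeTransitionFunction p r)
    {α : ℝ} (hα : 0 < α) (hα1 : α < 1) (x z : S) (F : Finset S) :
    ∑ y ∈ F, r x y * ((1 - α) * tabooResolvent p α x y z)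
      ≤ (∑' y, r x y + 1) * (G α x z / G α x x) := by
  set lam := ∑' y, r x y with hlam
  have hlam0 : 0 ≤ lam := tsum_nonneg (hp.rate_nonneg x)
  have hG := hp.one_le_greenKernel hα1 x
  have hG0 : G α x x ≠ 0 := by linarith
  have h := ((hp.hasSum_rate_mul_resolvent hα x z).sub
    ((hp.hasSum_rate_mul_resolvent hα x x).mul_right (G α x z / G α x x))).mul_left (1 - α)
  have h2 : HasSum (fun y => r x y * ((1 - α) * tabooResolvent p α x y z)) _ :=
    h.congr_fun fun y => by rw [tabooResolvent]; ring
  refine (sum_le_hasSum F (fun y _ => mul_nonneg (hp.rate_nonneg x y)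
    (mul_nonneg (sub_nonneg.2 hα1.le) (hp.tabooResolvent_nonneg hα hα1 x y z))) h2).trans ?_
  rw [← hlam, if_pos rfl]
  by_cases hz : x = z
  · subst hz
    rw [if_pos rfl, div_self hG0]
    linarith
  · rw [if_neg hz]
    have e1 : (1 - α) * R α x z = G α x z / G α x x * G α x x := by
      rw [div_mul_cancel₀ _ hG0]; simp [greenKernel, hz]
    have e2 : (1 - α) * R α x x = G α x x - 1 := by simp [greenKernel]
    apply le_of_eq
    linear_combination (lam + α) * e1 - (lam + α) * (G α x z / G α x x) * e2

/-! ### States charged by a stationary measure. -/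

section Stationary

variable {μ h : S → ℝ}

theorem mul_transition_le (hp : IsConservativeTransitionFunction p r) (hμ0 : ∀ y, 0 ≤ μ y)
    (hμ : ∀ t, 0 ≤ t → ∀ z, HasSum (fun y => μ y * p t y z) (μ z)) (t : ℝ) (y z : S) :
    μ y * p t y z ≤ μ z := by
  rw [hp.eq_max]
  exact le_hasSum (hμ _ (le_max_right t 0) z) y fun w _ => mul_nonneg (hμ0 w) (hp.nonneg _ w z)

theorem hasSum_mul_resolvent_of_stationary [Countable S] (hp : IsConservativeTransitionFunction p r)
    (hμ0 : ∀ y, 0 ≤ μ y)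
    (hμ : ∀ t, 0 ≤ t → ∀ z, HasSum (fun y => μ y * p t y z) (μ z)) {α : ℝ} (hα : 0 < α) (z : S) :
    HasSum (fun y => μ y * R α y z) (α⁻¹ * μ z) := by
  have h := hp.hasSum_mul_resolvent hα (fun y => y) (fun _ => z) μ (C := μ z) fun t ht F => by
    simp_rw [abs_of_nonneg (hμ0 _)]
    exact sum_le_hasSum F (fun y _ => mul_nonneg (hμ0 y) (hp.nonneg t y z)) (hμ t ht z)
  have e : ∫ t in Set.Ioi (0 : ℝ), Real.exp (-α * t) * ∑' y, μ y * p t y z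
      = ∫ t in Set.Ioi (0 : ℝ), Real.exp (-α * t) * μ z :=
    setIntegral_congr_fun measurableSet_Ioi fun t ht => by
      simp only [(hμ t (le_of_lt ht) z).tsum_eq]
  rwa [e, integral_mul_const, integral_exp_neg_mul_Ioi hα] at h

/-- Integrate the nonnegativity of the taboo resolvent against `μ`: stationarity turns both columns
into multiples `α⁻¹ μ`. -/
theorem mul_greenKernel_div_le [Countable S] (hp : IsConservativeTransitionFunction p r)
    (hμ0 : ∀ y, 0 ≤ μ y)
    (hμ : ∀ t, 0 ≤ t → ∀ z, HasSum (fun y => μ y * p t y z) (μ z)) {α : ℝ} (hα : 0 < α)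
    (hα1 : α < 1) (x z : S) : μ x * (G α x z / G α x x) ≤ μ z := by
  have h := hasSum_le (fun y => mul_le_mul_of_nonneg_left
      (sub_nonneg.1 (hp.tabooResolvent_nonneg hα hα1 x y z)) (hμ0 y))
    (((hp.hasSum_mul_resolvent_of_stationary hμ0 hμ hα x).mul_right
      (G α x z / G α x x)).congr_fun fun y => by ring)
    (hp.hasSum_mul_resolvent_of_stationary hμ0 hμ hα z)
  rw [mul_assoc] at h
  exact le_of_mul_le_mul_left h (inv_pos.2 hα)

theorem pos_of_rate_ne_zero (hp : IsConservativeTransitionFunction p r) (hμ0 : ∀ y, 0 ≤ μ y)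
    (hμ : ∀ t, 0 ≤ t → ∀ z, HasSum (fun y => μ y * p t y z) (μ z)) {x y : S} (hx : 0 < μ x)
    (hr : r x y ≠ 0) : 0 < μ y := by
  have hxy : x ≠ y := by rintro rfl; exact hr (hp.rate_self x)
  have hr0 : 0 < r x y := lt_of_le_of_ne (hp.rate_nonneg x y) hr.symm
  obtain ⟨t, ht, ht0⟩ := (((hp.jump x y hxy).eventually (lt_mem_nhds hr0)).and
    self_mem_nhdsWithin).exists
  have hpos : 0 < p t x y := by
    have := mul_pos ht (Set.mem_Ioi.1 ht0)
    rwa [div_mul_cancel₀ _ (ne_of_gt (Set.mem_Ioi.1 ht0))] at this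
  exact (mul_pos hx hpos).trans_le (hp.mul_transition_le hμ0 hμ t x y)

/-- The right side is free of `t` and summable in `z`, which makes expectations from charged states
bounded and continuous. -/
theorem transition_mul_le (hp : IsConservativeTransitionFunction p r) (hμ0 : ∀ y, 0 ≤ μ y)
    (hμ : ∀ t, 0 ≤ t → ∀ z, HasSum (fun y => μ y * p t y z) (μ z)) {y : S} (hy : 0 < μ y)
    (t : ℝ) (z : S) : |h z| * p t y z ≤ μ z * |h z| / μ y := by
  rw [le_div_iff₀ hy]
  nlinarith [mul_le_mul_of_nonneg_left (hp.mul_transition_le hμ0 hμ t y z) (abs_nonneg (h z))]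

theorem norm_transition_mul_le (hp : IsConservativeTransitionFunction p r) (hμ0 : ∀ y, 0 ≤ μ y)
    (hμ : ∀ t, 0 ≤ t → ∀ z, HasSum (fun y => μ y * p t y z) (μ z)) {y : S} (hy : 0 < μ y)
    (t : ℝ) (z : S) : ‖h z * p t y z‖ ≤ μ z * |h z| / μ y := by
  rw [norm_mul, Real.norm_of_nonneg (hp.nonneg t y z), Real.norm_eq_abs]
  exact hp.transition_mul_le hμ0 hμ hy t z

theorem continuous_expectation (hp : IsConservativeTransitionFunction p r) (hμ0 : ∀ y, 0 ≤ μ y)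
    (hμ : ∀ t, 0 ≤ t → ∀ z, HasSum (fun y => μ y * p t y z) (μ z))
    (hh : Summable fun z => μ z * |h z|) {y : S} (hy : 0 < μ y) :
    Continuous fun t => ∑' z, h z * p t y z :=
  continuous_tsum (fun z => (hp.continuous y z).const_mul _) (hh.div_const (μ y))
    fun z t => hp.norm_transition_mul_le hμ0 hμ hy t z

theorem abs_expectation_le (hp : IsConservativeTransitionFunction p r) (hμ0 : ∀ y, 0 ≤ μ y)
    (hμ : ∀ t, 0 ≤ t → ∀ z, HasSum (fun y => μ y * p t y z) (μ z))
    (hh : Summable fun z => μ z * |h z|) {y : S} (hy : 0 < μ y) (t : ℝ) :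
    |∑' z, h z * p t y z| ≤ ∑' z, μ z * |h z| / μ y :=
  tsum_of_norm_bounded (hh.div_const (μ y)).hasSum
    fun z => hp.norm_transition_mul_le hμ0 hμ hy t z

theorem hasSum_mul_resolvent_expectation [Countable S] (hp : IsConservativeTransitionFunction p r)
    (hμ0 : ∀ y, 0 ≤ μ y)
    (hμ : ∀ t, 0 ≤ t → ∀ z, HasSum (fun y => μ y * p t y z) (μ z))
    (hh : Summable fun z => μ z * |h z|) {y : S} (hy : 0 < μ y) {α : ℝ} (hα : 0 < α) :
    HasSum (fun z => h z * R α y z)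
      (∫ t in Set.Ioi (0 : ℝ), Real.exp (-α * t) * ∑' z, h z * p t y z) :=
  hp.hasSum_mul_resolvent hα (fun _ => y) (fun z => z) h (C := ∑' z, μ z * |h z| / μ y)
    fun t _ F => (Finset.sum_le_sum fun z _ => hp.transition_mul_le hμ0 hμ hy t z).trans
      ((hh.div_const (μ y)).sum_le_tsum F fun z _ =>
        div_nonneg (mul_nonneg (hμ0 z) (abs_nonneg _)) hy.le)

theorem tendsto_tsum_mul_resolvent [Countable S] (hp : IsConservativeTransitionFunction p r)
    (hμ0 : ∀ y, 0 ≤ μ y)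
    (hμ : ∀ t, 0 ≤ t → ∀ z, HasSum (fun y => μ y * p t y z) (μ z))
    (hh : Summable fun z => μ z * |h z|) {y : S} (hy : 0 < μ y) {L : ℝ}
    (hL : Tendsto (fun T => ∫ t in (0 : ℝ)..T, ∑' z, h z * p t y z) atTop (𝓝 L)) :
    Tendsto (fun α => ∑' z, h z * R α y z) (𝓝[>] 0) (𝓝 L) := by
  refine (tendsto_integral_exp_neg_mul (hp.continuous_expectation hμ0 hμ hh hy)
    (fun t _ => hp.abs_expectation_le hμ0 hμ hh hy t) hL).congr' ?_
  filter_upwards [self_mem_nhdsWithin] with α hα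
  exact (hp.hasSum_mul_resolvent_expectation hμ0 hμ hh hy hα).tsum_eq.symm

theorem hasSum_rate_mul_tsum_resolvent [Countable S] (hp : IsConservativeTransitionFunction p r)
    (hμ0 : ∀ y, 0 ≤ μ y)
    (hμ : ∀ t, 0 ≤ t → ∀ z, HasSum (fun y => μ y * p t y z) (μ z))
    (hh : Summable fun z => μ z * |h z|) {x : S} (hx : 0 < μ x) {α : ℝ} (hα : 0 < α) :
    HasSum (fun y => r x y * ∑' z, h z * R α y z)
      ((∑' y, r x y + α) * ∑' z, h z * R α x z - h x) := by
  have hRx := (hp.hasSum_mul_resolvent_expectation hμ0 hμ hh hx hα).summable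
  have hcol : ∀ z, HasSum (fun y => h z * (r x y * R α y z))
      (h z * ((∑' y, r x y + α) * R α x z - if x = z then 1 else 0)) := fun z =>
    (hp.hasSum_rate_mul_resolvent hα x z).mul_left (h z)
  have htot : HasSum (fun z => h z * ((∑' y, r x y + α) * R α x z - if x = z then 1 else 0))
      ((∑' y, r x y + α) * ∑' z, h z * R α x z - h x) := by
    refine ((hRx.hasSum.mul_left (∑' y, r x y + α)).sub (hasSum_ite_eq x (h x))).congr_fun
      fun z => ?_
    by_cases hz : x = z
    · subst hz; simp; ring
    · simp [hz, Ne.symm hz]; ring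
  refine hasSum_of_summable_prod (F := fun z y => h z * (r x y * R α y z)) ?_ hcol (fun y => ?_) htot
  · rw [← summable_norm_iff]
    refine (summable_prod_of_nonneg fun _ => norm_nonneg _).2 ⟨fun z => (hcol z).summable.norm, ?_⟩
    refine htot.summable.norm.congr fun z => ?_
    have e : ∀ y, ‖h z * (r x y * R α y z)‖ = |h z| * (r x y * R α y z) := fun y => by
      rw [norm_mul, Real.norm_of_nonneg (mul_nonneg (hp.rate_nonneg x y)
        (hp.resolvent_nonneg α y z)), Real.norm_eq_abs]
    have h1 := hp.hasSum_rate_mul_resolvent hα x z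
    simp only [e]
    rw [(h1.mul_left |h z|).tsum_eq, norm_mul, Real.norm_eq_abs,
      Real.norm_of_nonneg (h1.nonneg fun y => mul_nonneg (hp.rate_nonneg x y)
        (hp.resolvent_nonneg α y z))]
  · by_cases hr : r x y = 0
    · simp [hr]
    · have hy := hp.pos_of_rate_ne_zero hμ0 hμ hx hr
      have h1 := (hp.hasSum_mul_resolvent_expectation hμ0 hμ hh hy hα).summable.hasSum.mul_left
        (r x y)
      refine h1.congr_fun fun z => ?_
      ring

/-- First-passage decomposition of the resolvent at `x`, as a bound. -/
theorem abs_tsum_mul_resolvent_le [Countable S] (hp : IsConservativeTransitionFunction p r)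
    (hμ0 : ∀ y, 0 ≤ μ y)
    (hμ : ∀ t, 0 ≤ t → ∀ z, HasSum (fun y => μ y * p t y z) (μ z))
    (hh : Summable fun z => μ z * |h z|) {x y : S} (hx : 0 < μ x) (hy : 0 < μ y) (hyx : y ≠ x)
    {α : ℝ} (hα : 0 < α) (hα1 : α < 1)
    (hs : Summable fun z => (1 - α) * tabooResolvent p α x y z * |h z|) :
    (1 - α) * |∑' z, h z * R α y z|
      ≤ ∑' z, (1 - α) * tabooResolvent p α x y z * |h z|
        + (|h x| + |∑' z, h z * R α x z|) := by
  have hb : 0 ≤ 1 - α := sub_nonneg.2 hα1.le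
  have hG := hp.one_le_greenKernel hα1 x
  have hRx := (hp.hasSum_mul_resolvent_expectation hμ0 hμ hh hx hα).summable.hasSum
  have hRy := (hp.hasSum_mul_resolvent_expectation hμ0 hμ hh hy hα).summable.hasSum
  set gx := ∑' z, h z * R α x z with hgx
  set gy := ∑' z, h z * R α y z with hgy
  have hrho : HasSum (fun z => h z * G α x z) (h x + (1 - α) * gx) := by
    refine ((hasSum_ite_eq x (h x)).add (hRx.mul_left (1 - α))).congr_fun fun z => ?_
    by_cases hz : x = z
    · subst hz; simp [greenKernel]; ring
    · simp [greenKernel, hz, Ne.symm hz]; ring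
  -- `θ` is the discounted probability of reaching `x` from `y`; it multiplies the contribution
  -- collected from `x` onwards.
  set θ := G α y x / G α x x with hθ
  have hθ0 : 0 ≤ θ := div_nonneg (hp.greenKernel_nonneg hα1 y x) (by linarith)
  have hθ1 : θ ≤ 1 := div_le_one_of_le₀ (hp.greenKernel_le_diag hα hα1 x y) (by linarith)
  have hdec : HasSum (fun z => h z * ((1 - α) * tabooResolvent p α x y z))
      ((1 - α) * gy - θ * (h x + (1 - α) * gx)) := by
    refine ((hRy.mul_left (1 - α)).sub (hrho.mul_left θ)).congr_fun fun z => ?_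
    have e : G α y x = (1 - α) * R α y x := by simp [greenKernel, hyx]
    rw [hθ, e, tabooResolvent]
    ring
  have h1 : |(1 - α) * gy - θ * (h x + (1 - α) * gx)|
      ≤ ∑' z, (1 - α) * tabooResolvent p α x y z * |h z| := by
    rw [← hdec.tsum_eq, ← Real.norm_eq_abs]
    refine tsum_of_norm_bounded hs.hasSum fun z => ?_
    rw [norm_mul, Real.norm_of_nonneg (mul_nonneg hb (hp.tabooResolvent_nonneg hα hα1 x y z)),
      Real.norm_eq_abs, mul_comm]
  have h2 : |θ * (h x + (1 - α) * gx)| ≤ |h x| + |gx| := by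
    rw [abs_mul, abs_of_nonneg hθ0]
    refine (mul_le_of_le_one_left (abs_nonneg _) hθ1).trans ((abs_add_le _ _).trans ?_)
    rw [abs_mul, abs_of_nonneg hb]
    have := mul_le_of_le_one_left (abs_nonneg gx) (by linarith : 1 - α ≤ 1)
    linarith
  have h3 := abs_sub_abs_le_abs_sub ((1 - α) * gy) (θ * (h x + (1 - α) * gx))
  rw [← abs_of_nonneg hb, ← abs_mul, abs_of_nonneg hb]
  linarith

/-- The Poisson equation at a state charged by a stationary measure. -/
theorem hasSum_rate_mul_of_stationary [Countable S] (hp : IsConservativeTransitionFunction p r)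
    (hμ0 : ∀ y, 0 ≤ μ y)
    (hμ : ∀ t, 0 ≤ t → ∀ z, HasSum (fun y => μ y * p t y z) (μ z))
    (hh : Summable fun z => μ z * |h z|) {x : S} (hx : 0 < μ x) {g : S → ℝ}
    (hg : ∀ y, Tendsto (fun T => ∫ t in (0 : ℝ)..T, ∑' z, h z * p t y z) atTop (𝓝 (g y))) :
    HasSum (fun y => r x y * g y) ((∑' y, r x y) * g x - h x) := by
  -- A decreasing sequence with `α n ≤ 1 / 2`: monotonicity serves the taboo bound, and `1 - α n ≥ 1
  -- / 2` accounts for the factor `2` in `hbound`.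
  set α : ℕ → ℝ := fun n => 1 / ((n : ℝ) + 2) with hαdef
  have hα0 : ∀ n, 0 < α n := fun n => by positivity
  have hα2 : ∀ n, α n ≤ 1 / 2 := fun n =>
    one_div_le_one_div_of_le (by norm_num) (by have := n.cast_nonneg (α := ℝ); linarith)
  have hα1 : ∀ n, α n < 1 := fun n => (hα2 n).trans_lt (by norm_num)
  have hanti : Antitone α := fun m n hmn => one_div_le_one_div_of_le (by positivity)
    (by have : (m : ℝ) ≤ n := Nat.cast_le.2 hmn
        linarith)
  have hlim0 : Tendsto α atTop (𝓝 0) := by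
    have := (tendsto_one_div_add_atTop_nhds_zero_nat (𝕜 := ℝ)).comp (tendsto_add_atTop_nat 1)
    refine this.congr fun n => ?_
    simp only [Function.comp_apply, hαdef]
    push_cast
    congr 1
    ring
  have hlim : Tendsto α atTop (𝓝[>] 0) :=
    tendsto_nhdsWithin_iff.2 ⟨hlim0, Eventually.of_forall hα0⟩
  set gα : ℕ → S → ℝ := fun n y => ∑' z, h z * R (α n) y z with hgα
  have hgy : ∀ y, 0 < μ y → Tendsto (fun n => gα n y) atTop (𝓝 (g y)) := fun y hy =>
    (hp.tendsto_tsum_mul_resolvent hμ0 hμ hh hy (hg y)).comp hlim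
  obtain ⟨M, hM⟩ : ∃ M, ∀ n, |gα n x| ≤ M := by
    obtain ⟨M, hM⟩ := (hgy x hx).abs.bddAbove_range
    exact ⟨M, fun n => hM ⟨n, rfl⟩⟩
  -- `B y` controls, uniformly in `n`, the part of `r x y * gα n y` collected before the first visit
  -- to `x`.
  obtain ⟨B, hB, hBle⟩ := exists_summable_bound_tsum_of_monotone
    (a := fun n y z => r x y * ((1 - α n) * tabooResolvent p (α n) x y z) * |h z|)
    (c := fun z => (∑' y, r x y + 1) * ((μ x)⁻¹ * (μ z * |h z|)))
    (fun n y z => mul_nonneg (mul_nonneg (hp.rate_nonneg x y)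
      (mul_nonneg (sub_nonneg.2 (hα1 n).le) (hp.tabooResolvent_nonneg (hα0 n) (hα1 n) x y z)))
      (abs_nonneg _))
    (fun y z m n hmn => by
      by_cases hyx : y = x
      · simp [hyx, hp.rate_self]
      · exact mul_le_mul_of_nonneg_right (mul_le_mul_of_nonneg_left
          (hp.tabooResolvent_anti (hα0 n) (hanti hmn) (hα1 m) hyx z) (hp.rate_nonneg x y))
          (abs_nonneg _))
    ((hh.mul_left _).mul_left _)
    (fun n z F => by
      rw [← Finset.sum_mul]
      have h1 := hp.sum_rate_mul_tabooResolvent_le (hα0 n) (hα1 n) x z F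
      have h2 : G (α n) x z / G (α n) x x ≤ (μ x)⁻¹ * μ z := by
        rw [inv_mul_eq_div, le_div_iff₀ hx, mul_comm]
        exact hp.mul_greenKernel_div_le hμ0 hμ (hα0 n) (hα1 n) x z
      have hlam : 0 ≤ ∑' y, r x y + 1 :=
        add_nonneg (tsum_nonneg (hp.rate_nonneg x)) zero_le_one
      have h3 := mul_le_mul_of_nonneg_right
        (h1.trans (mul_le_mul_of_nonneg_left h2 hlam)) (abs_nonneg (h z))
      refine h3.trans (le_of_eq ?_)
      ring)
  have hbound : ∀ n y, ‖r x y * gα n y‖ ≤ 2 * (B y + r x y * (|h x| + M)) := fun n y => by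
    by_cases hr : r x y = 0
    · have h0 := (tsum_nonneg fun z => by simp [hr]).trans (hBle n y).2
      simpa [hr] using h0
    · have hyx : y ≠ x := by rintro rfl; exact hr (hp.rate_self y)
      have hy := hp.pos_of_rate_ne_zero hμ0 hμ hx hr
      have hr0 := hp.rate_nonneg x y
      obtain ⟨h1, h2⟩ := hBle n y
      simp only [mul_assoc (r x y)] at h1 h2
      rw [tsum_mul_left] at h2
      have h3 := hp.abs_tsum_mul_resolvent_le hμ0 hμ hh hx hy hyx (hα0 n) (hα1 n)
        ((summable_mul_left_iff hr).1 h1)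
      have h4 : (1 - α n) * |gα n y| ≥ 1 / 2 * |gα n y| :=
        mul_le_mul_of_nonneg_right (by linarith [hα2 n]) (abs_nonneg _)
      rw [norm_mul, Real.norm_of_nonneg hr0, Real.norm_eq_abs]
      have h5 : |gα n y| ≤ 2 * (∑' z, (1 - α n) * tabooResolvent p (α n) x y z * |h z|
          + (|h x| + M)) := by
        have := hM n
        simp only [hgα] at this h4 ⊢
        linarith
      have h6 := mul_le_mul_of_nonneg_left h5 hr0
      linarith
  have hbs : Summable fun y => 2 * (B y + r x y * (|h x| + M)) :=
    (hB.add ((hp.summable_rate x).mul_right _)).mul_left 2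
  have hpt : ∀ y, Tendsto (fun n => r x y * gα n y) atTop (𝓝 (r x y * g y)) := fun y => by
    by_cases hr : r x y = 0
    · simp [hr]
    · exact (hgy y (hp.pos_of_rate_ne_zero hμ0 hμ hx hr)).const_mul _
  have hs : Summable fun y => r x y * g y := Summable.of_norm_bounded hbs fun y =>
    le_of_tendsto' (hpt y).norm fun n => hbound n y
  have h1 := tendsto_tsum_of_dominated_convergence hbs hpt
    (Eventually.of_forall fun n y => hbound n y)
  have h2 : Tendsto (fun n => ∑' y, r x y * gα n y) atTop
      (𝓝 ((∑' y, r x y + 0) * g x - h x)) := by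
    refine (((hlim0.const_add _).mul (hgy x hx)).sub_const (h x)).congr fun n => ?_
    exact (hp.hasSum_rate_mul_tsum_resolvent hμ0 hμ hh hx (hα0 n)).tsum_eq.symm
  rw [add_zero] at h2
  have h3 := hs.hasSum
  rwa [tendsto_nhds_unique h1 h2] at h3

end Stationary

end IsConservativeTransitionFunction

/-! ### States with finitely many possible transitions. -/

theorem integrable_tsum_of_sum_norm_le {ι : Type*} [Countable ι] {μ : Measure ℝ}
    {f : ι → ℝ → ℝ} {bound : ℝ → ℝ} (hf : ∀ i, AEStronglyMeasurable (f i) μ)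
    (hb : Integrable bound μ)
    (h : ∀ᵐ t ∂μ, ∀ F : Finset ι, ∑ i ∈ F, ‖f i t‖ ≤ bound t) :
    Integrable (fun t => ∑' i, f i t) μ := by
  have hs : ∀ᵐ t ∂μ, Summable fun i => ‖f i t‖ := by
    filter_upwards [h] with t ht using summable_of_sum_le (fun i => norm_nonneg _) ht
  have hm : AEStronglyMeasurable (fun t => ∑' i, f i t) μ := by
    refine aestronglyMeasurable_of_tendsto_ae (atTop : Filter (Finset ι))
      (f := fun F t => ∑ i ∈ F, f i t)
      (fun F => Finset.aestronglyMeasurable_fun_sum F fun i _ => hf i) ?_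
    filter_upwards [hs] with t ht using ht.of_norm.hasSum
  refine hb.mono' hm ?_
  filter_upwards [h, hs] with t ht hst
  exact (norm_tsum_le_tsum_norm hst).trans (hst.tsum_le_of_sum_le ht)

/-- The integral over `[T, T + 1]` tends to `B`, and also to `L - L = 0`. -/
theorem eq_zero_of_tendsto_of_tendsto_integral {f : ℝ → ℝ} {B L : ℝ}
    (hi : ∀ T, 0 ≤ T → IntervalIntegrable f volume 0 T) (hf : Tendsto f atTop (𝓝 B))
    (hL : Tendsto (fun T => ∫ t in (0 : ℝ)..T, f t) atTop (𝓝 L)) : B = 0 := by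
  have h1 : Tendsto (fun T => (∫ t in (0 : ℝ)..(T + 1), f t) - ∫ t in (0 : ℝ)..T, f t) atTop
      (𝓝 0) := by
    have := (hL.comp (tendsto_atTop_add_const_right atTop 1 tendsto_id)).sub hL
    simpa using this
  have h2 : Tendsto (fun T => (∫ t in (0 : ℝ)..(T + 1), f t) - ∫ t in (0 : ℝ)..T, f t) atTop
      (𝓝 B) := by
    rw [Metric.tendsto_atTop]
    intro ε hε
    obtain ⟨T₀, hT₀⟩ := Metric.tendsto_atTop.1 hf (ε / 2) (half_pos hε)
    refine ⟨max T₀ 0, fun T hT => ?_⟩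
    have hT0 : 0 ≤ T := (le_max_right _ _).trans hT
    have hii : IntervalIntegrable f volume T (T + 1) :=
      (hi T hT0).symm.trans (hi (T + 1) (by linarith))
    rw [intervalIntegral.integral_interval_sub_left (hi _ (by linarith)) (hi _ hT0), dist_eq_norm]
    have e : (∫ t in T..(T + 1), f t) - B = ∫ t in T..(T + 1), (f t - B) := by
      rw [intervalIntegral.integral_sub hii (by simp)]
      simp
    rw [e]
    refine (intervalIntegral.norm_integral_le_of_norm_le_const (C := ε / 2) fun t ht => ?_).trans_lt
      (by simp; linarith)
    rw [Set.uIoc_of_le (by linarith)] at ht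
    rw [← dist_eq_norm]
    exact (hT₀ t ((le_max_left _ _).trans (hT.trans ht.1.le))).le
  exact tendsto_nhds_unique h2 h1

namespace IsConservativeTransitionFunction

variable {S : Type*} [DecidableEq S] {p : ℝ → S → S → ℝ} {r : S → S → ℝ} {h : S → ℝ}

theorem mul_le_transition_add (hp : IsConservativeTransitionFunction p r) {s t : ℝ} (hs : 0 ≤ s)
    (ht : 0 ≤ t) (x y z : S) : p s x y * p t y z ≤ p (s + t) x z :=
  le_hasSum (hp.chapman s t hs ht x z) y fun w _ => mul_nonneg (hp.nonneg s x w) (hp.nonneg t w z)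

theorem pow_le_transition_self (hp : IsConservativeTransitionFunction p r) {s : ℝ} (hs : 0 ≤ s)
    (y : S) (n : ℕ) : p s y y ^ n ≤ p (n * s) y y := by
  induction n with
  | zero => simp [hp.zero]
  | succ n ih =>
    have h1 := hp.mul_le_transition_add (mul_nonneg n.cast_nonneg hs) hs y y y
    have h2 := mul_le_mul_of_nonneg_right ih (hp.nonneg s y y)
    have e : ((n + 1 : ℕ) : ℝ) * s = n * s + s := by push_cast; ring
    rw [pow_succ, e]
    exact h2.trans h1

/-- Staying put at each multiple of `t / n` gives the lower bound `p (t / n) y y ^ n`, positive for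
large `n` by continuity at zero. -/
theorem transition_self_pos (hp : IsConservativeTransitionFunction p r) {t : ℝ} (ht : 0 ≤ t)
    (y : S) : 0 < p t y y := by
  have h0 : ∀ᶠ s in 𝓝 (0 : ℝ), 0 < p s y y :=
    (hp.continuous y y).continuousAt.eventually (lt_mem_nhds (by simp [hp.zero]))
  obtain ⟨n, hn, hn0⟩ := (((tendsto_const_div_atTop_nhds_zero_nat t).eventually h0).and
    (eventually_gt_atTop 0)).exists
  have h1 := hp.pow_le_transition_self (div_nonneg ht n.cast_nonneg) y n
  rw [mul_div_cancel₀ t (Nat.cast_ne_zero.2 hn0.ne')] at h1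
  exact (pow_pos hn n).trans_le h1

/-- Without stationarity, moments on `[0, T]` are compared with the moment at `T`: `p_t(y,z)
p_{T-t}(y,y) ≤ p_T(y,z)`. The return probability is bounded below on the compact interval. -/
theorem exists_sum_mul_transition_le (hp : IsConservativeTransitionFunction p r) (y : S)
    (hh : ∀ t, 0 ≤ t → Summable fun z => |h z| * p t y z) {T : ℝ} (hT : 0 ≤ T) :
    ∃ C, ∀ t ∈ Set.Icc 0 T, ∀ F : Finset S, ∑ z ∈ F, |h z| * p t y z ≤ C := by
  obtain ⟨t₀, ht₀, hmin⟩ := (isCompact_Icc (a := (0 : ℝ)) (b := T)).exists_isMinOn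
    ⟨0, le_rfl, hT⟩ (hp.continuous y y).continuousOn
  have hc := hp.transition_self_pos ht₀.1 y
  refine ⟨(∑' z, |h z| * p T y z) / p t₀ y y, fun t ht F => ?_⟩
  rw [le_div_iff₀ hc, Finset.sum_mul]
  refine le_trans (Finset.sum_le_sum fun z _ => ?_)
    ((hh T hT).sum_le_tsum F fun z _ => mul_nonneg (abs_nonneg _) (hp.nonneg T y z))
  have h1 : p t₀ y y ≤ p (T - t) y y := hmin ⟨sub_nonneg.2 ht.2, by linarith [ht.1]⟩
  have h2 := hp.mul_le_transition_add (sub_nonneg.2 ht.2) ht.1 y y z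
  rw [sub_add_cancel] at h2
  rw [mul_assoc]
  refine mul_le_mul_of_nonneg_left (le_trans ?_ h2) (abs_nonneg _)
  rw [mul_comm]
  exact mul_le_mul_of_nonneg_right h1 (hp.nonneg t y z)

theorem sum_norm_mul_transition_le (hp : IsConservativeTransitionFunction p r) {y : S} {T C : ℝ}
    (hC : ∀ t ∈ Set.Icc 0 T, ∀ F : Finset S, ∑ z ∈ F, |h z| * p t y z ≤ C) :
    ∀ᵐ t ∂volume.restrict (Set.Ioc 0 T), ∀ F : Finset S, ∑ z ∈ F, ‖h z * p t y z‖ ≤ C := by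
  filter_upwards [ae_restrict_mem measurableSet_Ioc] with t ht F
  refine le_trans (Finset.sum_le_sum fun z _ => ?_) (hC t (Set.Ioc_subset_Icc_self ht) F)
  rw [norm_mul, Real.norm_of_nonneg (hp.nonneg t y z), Real.norm_eq_abs]

theorem aestronglyMeasurable_mul_transition (hp : IsConservativeTransitionFunction p r)
    (μ : Measure ℝ) (y z : S) : AEStronglyMeasurable (fun t => h z * p t y z) μ :=
  ((hp.continuous y z).const_mul (h z)).aestronglyMeasurable

theorem intervalIntegrable_expectation [Countable S] (hp : IsConservativeTransitionFunction p r)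
    (y : S) (hh : ∀ t, 0 ≤ t → Summable fun z => |h z| * p t y z) {T : ℝ} (hT : 0 ≤ T) :
    IntervalIntegrable (fun t => ∑' z, h z * p t y z) volume 0 T := by
  obtain ⟨C, hC⟩ := hp.exists_sum_mul_transition_le y hh hT
  rw [intervalIntegrable_iff_integrableOn_Ioc_of_le hT]
  exact integrable_tsum_of_sum_norm_le (bound := fun _ => C)
    (fun z => hp.aestronglyMeasurable_mul_transition _ y z) (integrable_const C)
    (hp.sum_norm_mul_transition_le hC)

theorem hasSum_mul_intervalIntegral [Countable S] (hp : IsConservativeTransitionFunction p r)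
    (y : S) (hh : ∀ t, 0 ≤ t → Summable fun z => |h z| * p t y z) {T : ℝ} (hT : 0 ≤ T) :
    HasSum (fun z => h z * ∫ t in (0 : ℝ)..T, p t y z)
      (∫ t in (0 : ℝ)..T, ∑' z, h z * p t y z) := by
  obtain ⟨C, hC⟩ := hp.exists_sum_mul_transition_le y hh hT
  have h1 := hasSum_integral_of_sum_norm_le (bound := fun _ => C)
    (fun z => hp.aestronglyMeasurable_mul_transition (h := h) _ y z) (integrable_const C)
    (hp.sum_norm_mul_transition_le hC)
  simp only [integral_const_mul] at h1
  simpa only [intervalIntegral.integral_of_le hT] using h1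

/-- Dynkin's formula at a state with finitely many possible transitions. -/
theorem expectation_sub_eq_of_finite [Countable S] (hp : IsConservativeTransitionFunction p r)
    {x : S} (hfin : {y | r x y ≠ 0}.Finite)
    (hh : ∀ y t, 0 ≤ t → Summable fun z => |h z| * p t y z) {T : ℝ} (hT : 0 ≤ T) :
    ∑' z, h z * p T x z - h x
      = ∑ y ∈ hfin.toFinset, r x y * (∫ t in (0 : ℝ)..T, ∑' z, h z * p t y z)
        - (∑' y, r x y) * ∫ t in (0 : ℝ)..T, ∑' z, h z * p t x z := by
  have hk : ∀ z, ∑ y ∈ hfin.toFinset, r x y * (∫ t in (0 : ℝ)..T, p t y z)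
      = p T x z - (if x = z then 1 else 0) + (∑' y, r x y) * ∫ t in (0 : ℝ)..T, p t x z :=
    fun z => by
      -- Discount zero gives the undiscounted integrated backward equation.
      have h1 := hp.hasSum_rate_mul_intervalIntegral 0 hT x z
      simp only [neg_zero, zero_mul, Real.exp_zero, one_mul, add_zero] at h1
      refine (hasSum_sum_of_ne_finset_zero fun y hy => ?_).unique h1
      have : r x y = 0 := by simpa using hy
      rw [this, zero_mul]
  have hsT : HasSum (fun z => h z * p T x z) (∑' z, h z * p T x z) := by
    refine (Summable.of_norm ((hh x T hT).congr fun z => ?_)).hasSum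
    rw [norm_mul, Real.norm_of_nonneg (hp.nonneg T x z), Real.norm_eq_abs]
  have hR := ((hsT.sub (hasSum_ite_eq x (h x))).add
    ((hp.hasSum_mul_intervalIntegral x (hh x) hT).mul_left (∑' y, r x y)))
  have hL := hasSum_sum (s := hfin.toFinset) fun y _ =>
    (hp.hasSum_mul_intervalIntegral y (hh y) hT).mul_left (r x y)
  have e := hL.unique (hR.congr_fun fun z => by
    have e1 : ∑ y ∈ hfin.toFinset, r x y * (h z * ∫ t in (0 : ℝ)..T, p t y z)
        = h z * ∑ y ∈ hfin.toFinset, r x y * (∫ t in (0 : ℝ)..T, p t y z) := by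
      rw [Finset.mul_sum]
      exact Finset.sum_congr rfl fun y _ => by ring
    rw [e1, hk z]
    by_cases hz : x = z
    · subst hz; simp; ring
    · simp [hz, Ne.symm hz]; ring)
  linarith

/-- The Poisson equation at a state with finitely many possible transitions. -/
theorem hasSum_rate_mul_of_finite [Countable S] (hp : IsConservativeTransitionFunction p r)
    {x : S} (hfin : {y | r x y ≠ 0}.Finite)
    (hh : ∀ y t, 0 ≤ t → Summable fun z => |h z| * p t y z) {g : S → ℝ}
    (hg : ∀ y, Tendsto (fun T => ∫ t in (0 : ℝ)..T, ∑' z, h z * p t y z) atTop (𝓝 (g y))) :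
    HasSum (fun y => r x y * g y) ((∑' y, r x y) * g x - h x) := by
  have hs : HasSum (fun y => r x y * g y) (∑ y ∈ hfin.toFinset, r x y * g y) :=
    hasSum_sum_of_ne_finset_zero fun y hy => by
      have : r x y = 0 := by simpa using hy
      rw [this, zero_mul]
  have hlim : Tendsto (fun T => ∑' z, h z * p T x z) atTop
      (𝓝 (∑ y ∈ hfin.toFinset, r x y * g y - (∑' y, r x y) * g x + h x)) := by
    refine (((tendsto_finsetSum hfin.toFinset fun y _ => (hg y).const_mul (r x y)).sub
      ((hg x).const_mul (∑' y, r x y))).add_const (h x)).congr' ?_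
    filter_upwards [eventually_ge_atTop 0] with T hT
    rw [← hp.expectation_sub_eq_of_finite hfin hh hT, sub_add_cancel]
  have h0 := eq_zero_of_tendsto_of_tendsto_integral
    (fun T hT => hp.intervalIntegrable_expectation x (hh x) hT) hlim (hg x)
  have e : (∑' y, r x y) * g x - h x = ∑ y ∈ hfin.toFinset, r x y * g y := by linarith
  rwa [e]

end IsConservativeTransitionFunction

/-! ### From the lattice chain to its transition function. -/

theorem latticePoint_injective {d : ℕ} {δ : ℝ} (hδ : 0 < δ) :
    Function.Injective (latticePoint (d := d) δ) := fun k k' hk => by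
  funext i
  have h1 : δ * (k i : ℝ) = δ * (k' i : ℝ) := by
    simpa [latticePoint] using congrArg (fun v : EuclideanSpace ℝ (Fin d) => v i) hk
  exact_mod_cast mul_left_cancel₀ hδ.ne' h1

/-- The indices of the lattice points of the state space. -/
abbrev StateIndex {d : ℕ} (δ : ℝ) (E : Set (EuclideanSpace ℝ (Fin d))) : Type :=
  {k : Fin d → ℤ // latticePoint δ k ∈ E}

/-- The transition probabilities of the chain, as functions of a real time. -/
def transitionProb {d : ℕ} {Ω : Type*} [MeasurableSpace Ω] (δ : ℝ)
    (E : Set (EuclideanSpace ℝ (Fin d))) (P : EuclideanSpace ℝ (Fin d) → Measure Ω)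
    (X : ℝ≥0 → Ω → EuclideanSpace ℝ (Fin d)) (t : ℝ) (x y : StateIndex δ E) : ℝ :=
  (P (latticePoint δ x)).real {ω | X t.toNNReal ω = latticePoint δ y}

/-- The off-diagonal part of the rates, on the state space. -/
def offDiagRate {d : ℕ} (δ : ℝ) (E : Set (EuclideanSpace ℝ (Fin d)))
    (q : (Fin d → ℤ) → (Fin d → ℤ) → ℝ) (x y : StateIndex δ E) : ℝ :=
  if x = y then 0 else q x y

theorem Real.tendsto_toNNReal_nhdsGT_zero :
    Tendsto Real.toNNReal (𝓝[>] (0 : ℝ)) (𝓝[>] (0 : ℝ≥0)) := by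
  refine tendsto_nhdsWithin_iff.2 ⟨?_, ?_⟩
  · have := continuous_real_toNNReal.tendsto 0
    rw [Real.toNNReal_zero] at this
    exact this.mono_left nhdsWithin_le_nhds
  · filter_upwards [self_mem_nhdsWithin] with t ht
    exact Set.mem_Ioi.2 (Real.toNNReal_pos.2 ht)

section Chain

variable {d : ℕ} {Ω : Type*} [MeasurableSpace Ω] {δ : ℝ}
  {E : Set (EuclideanSpace ℝ (Fin d))} {q : (Fin d → ℤ) → (Fin d → ℤ) → ℝ}
  {P : EuclideanSpace ℝ (Fin d) → Measure Ω} {X : ℝ≥0 → Ω → EuclideanSpace ℝ (Fin d)}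

namespace IsCTMC

theorem measurableSet_eq (hX : IsCTMC δ E q P X) (t : ℝ≥0) (x : EuclideanSpace ℝ (Fin d)) :
    MeasurableSet {ω | X t ω = x} := hX.measurable t (measurableSet_singleton x)

theorem hasSum_setIntegral (hX : IsCTMC δ E q P X) (hδ : 0 < δ) (x : StateIndex δ E) (t : ℝ≥0)
    {f : Ω → ℝ} (hf : Integrable f (P (latticePoint δ x))) :
    HasSum (fun y : StateIndex δ E =>
      ∫ ω in {ω | X t ω = latticePoint δ y}, f ω ∂(P (latticePoint δ x)))
      (∫ ω, f ω ∂(P (latticePoint δ x))) := by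
  have h := hasSum_integral_iUnion (μ := P (latticePoint δ x)) (f := f)
    (s := fun y : StateIndex δ E => {ω | X t ω = latticePoint δ y})
    (fun y => hX.measurableSet_eq t _)
    (fun y z hyz => Set.disjoint_left.2 fun ω h1 h2 =>
      hyz (Subtype.ext (latticePoint_injective hδ ((Set.mem_ofPred.1 h1).symm.trans h2))))
    hf.integrableOn
  have hU : (⋃ y : StateIndex δ E, {ω | X t ω = latticePoint δ y}) = Set.univ := by
    refine Set.eq_univ_of_forall fun ω => ?_
    obtain ⟨k, hk⟩ := hX.subset_lattice (hX.mem_states t ω)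
    exact Set.mem_iUnion.2 ⟨⟨k, hk ▸ hX.mem_states t ω⟩, hk.symm⟩
  rwa [hU, setIntegral_univ] at h

theorem hasSum_mul_transitionProb (hX : IsCTMC δ E q P X) (hδ : 0 < δ) (x : StateIndex δ E)
    (t : ℝ) {h : EuclideanSpace ℝ (Fin d) → ℝ}
    (hh : Integrable (fun ω => h (X t.toNNReal ω)) (P (latticePoint δ x))) :
    HasSum (fun y : StateIndex δ E => h (latticePoint δ y) * transitionProb δ E P X t x y)
      (∫ ω, h (X t.toNNReal ω) ∂(P (latticePoint δ x))) := by
  refine (hX.hasSum_setIntegral hδ x t.toNNReal hh).congr_fun fun y => ?_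
  rw [setIntegral_congr_fun (g := fun _ => h (latticePoint δ y)) (hX.measurableSet_eq _ _)
    (fun ω hω => by simp only [Set.mem_ofPred.1 hω]), setIntegral_const, smul_eq_mul, mul_comm]
  rfl

/-- Rates from `E` to lattice points outside `E` vanish, so restricting to the state space loses no
mass and the transition function is conservative. -/
theorem tsum_offDiagRate (hX : IsCTMC δ E q P X) (x : StateIndex δ E) :
    ∑' y, offDiagRate δ E q x y = exitRate q x := by
  have h := Function.Injective.tsum_eq (f := fun k' => if k' = x.1 then 0 else q x k')
    (g := (Subtype.val : StateIndex δ E → _)) Subtype.val_injective fun k' hk' => by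
      by_contra hne
      have hE : latticePoint δ k' ∉ E := fun hE => hne ⟨⟨k', hE⟩, rfl⟩
      simp [hX.rates.eq_zero x k' x.2 hE] at hk'
  rw [exitRate, ← h]
  refine tsum_congr fun y => ?_
  simp only [offDiagRate, Subtype.ext_iff, eq_comm]

theorem isConservativeTransitionFunction (hX : IsCTMC δ E q P X) (hδ : 0 < δ) :
    IsConservativeTransitionFunction (transitionProb δ E P X) (offDiagRate δ E q) where
  nonneg t x y := measureReal_nonneg
  hasSum_one t x := by
    have := hX.isProbability _ x.2
    simpa using hX.hasSum_mul_transitionProb hδ x t (h := fun _ => 1) (integrable_const 1)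
  eq_max t x y := by
    have : t.toNNReal = (max t 0).toNNReal := by
      rcases le_total t 0 with h | h
      · simp [h, Real.toNNReal_of_nonpos h]
      · simp [h]
    simp only [transitionProb, ← this]
  zero x y := by
    have := hX.isProbability _ x.2
    have hi := hX.initial _ x.2
    simp only [transitionProb, Real.toNNReal_zero]
    split_ifs with hxy
    · rw [← hxy, measureReal_def, (mem_ae_iff_prob_eq_one (hX.measurableSet_eq _ _)).1 hi, ENNReal.toReal_one]
    · rw [measureReal_def, ENNReal.toReal_eq_zero_iff]
      left
      refine measure_mono_null (fun ω hω => ?_) hi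
      intro h0
      exact hxy (Subtype.ext (latticePoint_injective hδ (h0.symm.trans hω)))
  chapman s t hs ht x z := by
    have := hX.isProbability _ x.2
    have h := hX.hasSum_setIntegral hδ x s.toNNReal
      (f := Set.indicator {ω | X (s + t).toNNReal ω = latticePoint δ z} fun _ => 1)
      ((integrable_const 1).indicator (hX.measurableSet_eq _ _))
    rw [integral_indicator (hX.measurableSet_eq _ _)] at h
    simp only [setIntegral_indicator (hX.measurableSet_eq _ _), setIntegral_const, smul_eq_mul,
      mul_one] at h
    refine h.congr_fun fun y => ?_
    have hm := hX.markov _ x.2 _ y.2 _ z.2 s.toNNReal t.toNNReal Set.univ MeasurableSet.univ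
    rw [Set.univ_inter, ← Real.toNNReal_add hs ht] at hm
    simp only [transitionProb, measureReal_def]
    rw [hm, ENNReal.toReal_mul]
  rate_nonneg x y := by
    rw [offDiagRate]
    split_ifs with h
    · exact le_rfl
    · exact hX.rates.nonneg _ _ x.2 fun h' => h (Subtype.ext h')
  rate_self x := if_pos rfl
  summable_rate x := by
    refine Summable.of_norm_bounded
      ((hX.rates.summable _ x.2).comp_injective Subtype.val_injective).norm fun y => ?_
    rw [offDiagRate]
    split_ifs <;> simp
  jump x y hxy := by
    have h := (hX.jump _ _ x.2 y.2 fun h => hxy (Subtype.ext h)).comp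
      Real.tendsto_toNNReal_nhdsGT_zero
    rw [offDiagRate, if_neg hxy]
    refine h.congr' ?_
    filter_upwards [self_mem_nhdsWithin] with t ht
    simp only [Function.comp_apply, transitionProb, Real.coe_toNNReal t (le_of_lt ht)]
  hold x := by
    have h := (hX.hold _ x.2).comp Real.tendsto_toNNReal_nhdsGT_zero
    rw [hX.tsum_offDiagRate]
    refine h.congr' ?_
    filter_upwards [self_mem_nhdsWithin] with t ht
    simp only [Function.comp_apply, transitionProb, Real.coe_toNNReal t (le_of_lt ht)]

theorem ctmcGenerator_eq (hX : IsCTMC δ E q P X) (f : EuclideanSpace ℝ (Fin d) → ℝ)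
    (x : StateIndex δ E) : ctmcGenerator δ q f x =
      ∑' y, offDiagRate δ E q x y * (f (latticePoint δ y) - f (latticePoint δ x)) := by
  have h := Function.Injective.tsum_eq
    (f := fun k' => q x k' * (f (latticePoint δ k') - f (latticePoint δ x)))
    (g := (Subtype.val : StateIndex δ E → _)) Subtype.val_injective fun k' hk' => by
      by_contra hne
      have hE : latticePoint δ k' ∉ E := fun hE => hne ⟨⟨k', hE⟩, rfl⟩
      simp [hX.rates.eq_zero x k' x.2 hE] at hk'
  rw [ctmcGenerator, ← h]
  refine tsum_congr fun y => ?_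
  rw [offDiagRate]
  split_ifs with hxy
  · simp [hxy]
  · rfl

theorem hasSum_stationary (hX : IsCTMC δ E q P X) (hδ : 0 < δ)
    {π : Measure (EuclideanSpace ℝ (Fin d))} (hπ : IsStationaryDistribution E P X π)
    (t : ℝ) (z : StateIndex δ E) :
    HasSum (fun y : StateIndex δ E => π.real {latticePoint δ y} * transitionProb δ E P X t y z)
      (π.real {latticePoint δ z}) := by
  have := hπ.isProbability
  have hbij : Function.Bijective
      (fun y : StateIndex δ E => (⟨latticePoint δ y, y.2⟩ : E)) := by
    refine ⟨fun y y' h => Subtype.ext (latticePoint_injective hδ (congrArg Subtype.val h)),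
      fun e => ?_⟩
    obtain ⟨k, hk⟩ := hX.subset_lattice e.2
    exact ⟨⟨k, hk ▸ e.2⟩, Subtype.ext hk⟩
  have hinv := hπ.invariant t.toNNReal _ z.2
  rw [← (Equiv.ofBijective _ hbij).tsum_eq] at hinv
  simp only [Equiv.ofBijective_apply] at hinv
  have hne : π {latticePoint δ z} ≠ ⊤ := measure_ne_top _ _
  have h := ENNReal.hasSum_toReal (hinv.trans_ne hne)
  rw [← ENNReal.tsum_toReal_eq fun y => ENNReal.ne_top_of_tsum_ne_top (hinv.trans_ne hne) y,
    hinv] at h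
  simpa only [ENNReal.toReal_mul, transitionProb, measureReal_def] using h

end IsCTMC

theorem summable_measureReal_singleton_mul (hδ : 0 < δ) (π : Measure (EuclideanSpace ℝ (Fin d)))
    {f : EuclideanSpace ℝ (Fin d) → ℝ} (hf : Integrable f π) :
    Summable fun y : StateIndex δ E => π.real {latticePoint δ y} * f (latticePoint δ y) := by
  have h := hasSum_integral_iUnion (μ := π) (f := f)
    (s := fun y : StateIndex δ E => {latticePoint δ (y : Fin d → ℤ)})
    (fun y => measurableSet_singleton _)
    (fun y z hyz => Set.disjoint_singleton.2 fun h =>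
      hyz (Subtype.ext (latticePoint_injective hδ h)))
    hf.integrableOn
  simpa [measureReal_def] using h.summable

end Chain

end

/-! ### The Poisson equation for the chain. -/

theorem mainTheorem8 {d : ℕ} {Ω : Type*} [MeasurableSpace Ω] (δ : ℝ) (hδ : 0 < δ)
    (E : Set (EuclideanSpace ℝ (Fin d))) (q : (Fin d → ℤ) → (Fin d → ℤ) → ℝ)
    (P : EuclideanSpace ℝ (Fin d) → Measure Ω)
    (X : ℝ≥0 → Ω → EuclideanSpace ℝ (Fin d)) (hX : IsCTMC δ E q P X)
    (π : Measure (EuclideanSpace ℝ (Fin d))) (hπ : IsStationaryDistribution E P X π)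
    -- every state with infinitely many possible transitions is charged by the stationary law
    (hcharge : ∀ k, latticePoint δ k ∈ E →
      0 < π {latticePoint δ k} ∨ {k' | q k k' ≠ 0}.Finite)
    -- the expectations that enter the integrand exist
    (h : EuclideanSpace ℝ (Fin d) → ℝ) (hh : Integrable h π)
    (hhX : ∀ x ∈ E, ∀ t : ℝ≥0, Integrable (fun ω => h (X t ω)) (P x))
    -- `g` is the (possibly only conditionally convergent) integral over `[0, ∞)`
    (g : EuclideanSpace ℝ (Fin d) → ℝ)
    (hg : ∀ x ∈ E, Tendsto
      (fun T : ℝ => ∫ t in (0 : ℝ)..T, ((∫ ω, h (X t.toNNReal ω) ∂(P x)) - ∫ y, h y ∂π))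
      atTop (𝓝 (g x)))
    (hsum : ∀ k, latticePoint δ k ∈ E → Summable fun l : Fin d → ℤ =>
      |jumpRate q l k * (g (latticePoint δ (k + l)) - g (latticePoint δ k))|) :
    ∀ k, latticePoint δ k ∈ E →
      ctmcGenerator δ q g k = (∫ y, h y ∂π) - h (latticePoint δ k) := by

  intro k hk
  set x : StateIndex δ E := ⟨k, hk⟩ with hx
  set c := ∫ y, h y ∂π with hc
  have hp := hX.isConservativeTransitionFunction hδ
  have := hπ.isProbability
  have hint : ∀ (y : StateIndex δ E) (t : ℝ),
      Integrable (fun ω => h (X t.toNNReal ω) - c) (P (latticePoint δ y)) := fun y t => by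
    have := hX.isProbability _ y.2
    exact (hhX _ y.2 _).sub (integrable_const c)
  -- Transition probabilities sum to one, so the centring constant can be moved into the sum.
  have hu : ∀ (y : StateIndex δ E) (t : ℝ),
      (∫ ω, h (X t.toNNReal ω) ∂(P (latticePoint δ y))) - c
        = ∑' z : StateIndex δ E, (h (latticePoint δ z) - c) * transitionProb δ E P X t y z := fun y t => by
    have := hX.isProbability _ y.2
    rw [(hX.hasSum_mul_transitionProb hδ y t (h := fun v => h v - c) (hint y t)).tsum_eq,
      integral_sub (hhX _ y.2 _) (integrable_const c)]
    simp
  have hlim : ∀ y : StateIndex δ E, Tendsto (fun T => ∫ t in (0 : ℝ)..T,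
      ∑' z : StateIndex δ E, (h (latticePoint δ z) - c) * transitionProb δ E P X t y z) atTop
      (𝓝 (g (latticePoint δ y))) := fun y => by
    simpa only [hu] using hg _ y.2
  have key : HasSum (fun y => offDiagRate δ E q x y * g (latticePoint δ y))
      ((∑' y, offDiagRate δ E q x y) * g (latticePoint δ x) - (h (latticePoint δ x) - c)) := by
    rcases hcharge k hk with hpos | hfin
    · exact hp.hasSum_rate_mul_of_stationary (μ := fun y : StateIndex δ E => π.real {latticePoint δ y})
        (h := fun z : StateIndex δ E => h (latticePoint δ z) - c) (fun y => measureReal_nonneg)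
        (fun t _ (z : StateIndex δ E) => hX.hasSum_stationary hδ hπ t z)
        (summable_measureReal_singleton_mul hδ π (hh.sub (integrable_const c)).abs)
        (ENNReal.toReal_pos hpos.ne' (measure_ne_top _ _)) hlim
    · refine hp.hasSum_rate_mul_of_finite (h := fun z : StateIndex δ E => h (latticePoint δ z) - c)
        ((hfin.preimage Subtype.val_injective.injOn).subset fun y hy => ?_) (fun y t _ => ?_) hlim
      · refine fun h0 => hy ?_
        simp only [offDiagRate, h0, ite_self, x]
      · exact (hX.hasSum_mul_transitionProb hδ y t (h := fun v => |h v - c|)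
          (hint y t).abs).summable
  have hgen := hX.ctmcGenerator_eq g x
  -- Subtracting `λ g(x)` turns the sum of `r(x,y) g(y)` into the generator.
  have hfin := key.sub ((hp.summable_rate x).hasSum.mul_right (g (latticePoint δ x)))
  simp only [← mul_sub] at hfin
  rw [hfin.tsum_eq] at hgen
  change ctmcGenerator δ q g k = _ at hgen
  rw [hgen]
  change _ = c - h (latticePoint δ x)
  ring
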